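/- **Setting.** Fix $n$ users $\mathcal U$ and a server $S$. For security parameter $k$ each user $u$ holds a model $x_u\in\{0,\dots,N-1\}^m$, where $m$ and the bit length of $N$ are bounded by polynomials in $k$ and all entries of $\sum_{u\in\mathcal U}x_u$ are also less than $N$. Algorithms are (probabilistic) polynomial-time. Two ensembles are computationally indistinguishable if every PPT distinguisher with polynomial-size advice has negligible advantage. All protocols are synchronous, with a number of rounds independent of $k$. **Adversary.** The adversary corrupts a set $Adv\subseteq\mathcal U\cup\{S\}$. A corrupted server follows the protocol, but its secret key, random bits and all messages it receives belong to the view of the adversary. Corrupted users send arbitrary messages, computed by a polynomial-time strategy from the joint view of all corrupted parties so far (which includes an auxiliary input of polynomial size; in the framework it also includes the adversary's random bits, and in each aggregation round the messages that the other parties send to corrupted parties in that round). Honest-but-curious users are the special case in which the strategy follows the protocol. **Components.** Let $(Gen,E,D)$ be a public-key encryption scheme; $S$ holds the secret key. Let $\mathcal U'\subseteq\mathcal U$ be the set of participating users and $\bar x=\sum_{u\in\mathcal U'}x_u$ the global model. 1. *User aggregation*: a protocol between the users and $S$ in which $S$ obtains a ciphertext $\bar c$. Assume that it is private: for every strategy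 there is a PPT simulator such that for all $Adv$, $\mathcal U'$, all models and all auxiliary inputs, the simulator, given $Adv$, $\mathcal U'$, the public key, the secret key if $S\in Adv$, the models of the corrupted users, the auxiliary input and a fresh encryption $E_{pk}(\bar x)$, produces an output computationally indistinguishable from the view of the adversary (which includes $\bar c$ if $S\in Adv$). 2. *Zero-knowledge proof of attack-free models*: a public-parameter generation, a commitment scheme $C$, and an interactive protocol between a prover $P$ (a user) and a verifier $V$ (the server). Assume that there is a PPT simulator which, given only the public parameters, produces a transcript that is, together with the public parameters, computationally indistinguishable from the one between the honest prover, with any attack-free model $x$, and the honest verifier. The transcript consists of the commitment to $x$, all messages and the random bits of $V$. 3. *Computing the global model*: $S$ validates the proofs, decrypts $\bar c$, and applies a polynomial-time test of the consistency of the result with the commitments whose proofs are valid. In the framework, the keys and the public parameters are generated honestly, the users run the proofs of component 2 with the server, then component 1 is run, and then $S$ performs component 3. **Theorem (privacy of the framework).** For every polynomial-time strategy of the corrupted users there is a PPT simulator $\mathcal S$ such that for every $Adv\subseteq\mathcal U\cup\{S\}$, every $\mathcal U'\subseteq\mathcal U$, all models such that the users in $\mathcal U'\setminus Adv$ have attack-free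 models, and every auxiliary input, the joint view of the parties in $Adv$ in an execution of the framework (including the result of component 3 if $S\in Adv$) is computationally indistinguishable from the output of $\mathcal S$, which is given only $Adv$, $\mathcal U'$, the inputs of the parties in $Adv$ (the models of the corrupted users, the public key, and the secret key if $S\in Adv$), the public parameters, the auxiliary input, and the global model $\bar x$. -/

import Mathlib

open Filter Asymptotics

noncomputable section

namespace FL

/-! ## Data and encodings -/

/-- Binary trees: the data on which all algorithms work. -/
inductive Data : Type
  | nil : Data
  | cons : Data → Data → Data

namespace Data

/-- The number of nodes of a tree. -/
def size : Data → ℕ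
  | nil => 1
  | cons a b => a.size + b.size + 1

def fst : Data → Data
  | nil => nil
  | cons a _ => a

def snd : Data → Data
  | nil => nil
  | cons _ b => b

/-- The number of entries of a tree read as a list. -/
def length : Data → ℕ
  | nil => 0
  | cons _ b => b.length + 1

def ofList : List Data → Data
  | [] => nil
  | a :: l => cons a (ofList l)

/-- The entries of a tree read as a list. -/
def toList : Data → List Data
  | nil => []
  | cons a b => a :: b.toList

/-- The entry number `i` of a tree read as a list (`nil` beyond its end). -/
def nth : Data → ℕ → Data
  | d, 0 => d.fst
  | d, i + 1 => d.snd.nth i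

def ofBool : Bool → Data
  | false => nil
  | true => cons nil nil

/-- The string `1^k`. -/
def unary (k : ℕ) : Data := ofList (List.replicate k nil)

/-- Numbers in binary. -/
def ofNat (a : ℕ) : Data := ofList ((Nat.bits a).map ofBool)

/-- Vectors of numbers. -/
def ofModel {m : ℕ} (x : Fin m → ℕ) : Data := ofList (List.ofFn fun i => ofNat (x i))

/-- `keep b d` is `d` if the flag `b` is set (not `nil`), and `nil` otherwise. -/
def keep : Data → Data → Data
  | nil, _ => nil
  | cons _ _, d => d

end Data

/-! ## Probabilistic algorithms with a step count -/

/-- A programming language on trees: projections, pairing, composition, conditionals, a fair coin,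
and a loop `loop c f`, which runs `f` on the current data as many times as the list computed by
`c` has entries. -/
inductive Prog : Type
  | nil : Prog
  | id : Prog
  | fst : Prog
  | snd : Prog
  | coin : Prog
  | pair : Prog → Prog → Prog
  | comp : Prog → Prog → Prog
  | ite : Prog → Prog → Prog → Prog
  | loop : Prog → Prog → Prog

/-- Repeat a step, adding up the running times. -/
def iterate (f : Data → PMF (Data × ℕ)) : ℕ → Data × ℕ → PMF (Data × ℕ)
  | 0, s => PMF.pure s
  | i + 1, s => (f s.1).bind fun r => iterate f i (r.1, s.2 + r.2 + 1)

/-- The joint distribution of the result and the running time of a program. An elementary step is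
charged the size of the data that it handles, so the size of a result never exceeds the time spent
on it. For programs whose time is bounded by a polynomial in the size of the input this is
equivalent to probabilistic Turing machines that halt in polynomial time on all coin flips (such a
machine carries a polynomial clock, so that bounded loops are enough). -/
def Prog.run : Prog → Data → PMF (Data × ℕ)
  | .nil, _ => PMF.pure (Data.nil, 1)
  | .id, d => PMF.pure (d, d.size + 1)
  | .fst, d => PMF.pure (d.fst, d.size + 1)
  | .snd, d => PMF.pure (d.snd, d.size + 1)
  | .coin, _ => (PMF.uniformOfFintype Bool).map fun b => (Data.ofBool b, 3)
  | .pair f g, d => (f.run d).bind fun a => (g.run d).map fun b =>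
      (Data.cons a.1 b.1, a.2 + b.2 + 1)
  | .comp g f, d => (f.run d).bind fun a => (g.run a.1).map fun b => (b.1, a.2 + b.2 + 1)
  | .ite c f g, d => (c.run d).bind fun a =>
      match a.1 with
      | Data.nil => (g.run d).map fun b => (b.1, a.2 + b.2 + 1)
      | Data.cons _ _ => (f.run d).map fun b => (b.1, a.2 + b.2 + 1)
  | .loop c f, d => (c.run d).bind fun a =>
      iterate f.run a.1.length (d, a.2 + d.size + 1)

/-- The running time is at most a polynomial in the size of the input, on all coin flips. -/
def Prog.PolyTime (p : Prog) : Prop :=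
  ∃ b : Polynomial ℕ, ∀ d, ∀ r ∈ (p.run d).support, r.2 ≤ b.eval d.size

/-- `f` is the input-output behaviour of a probabilistic polynomial-time algorithm. -/
def IsPPT (f : Data → PMF Data) : Prop :=
  ∃ p : Prog, p.PolyTime ∧ ∀ d, (p.run d).map Prod.fst = f d

/-- `f` is a function computable in polynomial time. -/
def IsPolyFun (f : Data → Data) : Prop := IsPPT fun d => PMF.pure (f d)

/-- A uniformly random string of `l` bits. -/
def bits : ℕ → PMF Data
  | 0 => PMF.pure Data.nil
  | l + 1 => (PMF.uniformOfFintype Bool).bind fun b => (bits l).map (Data.cons (Data.ofBool b))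

/-- A list of independent samples. -/
def samples : List (PMF Data) → PMF Data
  | [] => PMF.pure Data.nil
  | p :: l => p.bind fun a => (samples l).map (Data.cons a)

/-! ## Computational indistinguishability -/

/-- Sequences of data of polynomial size. -/
def PolyBounded (a : ℕ → Data) : Prop := ∃ b : Polynomial ℕ, ∀ k, (a k).size ≤ b.eval k

/-- The probability that the distinguisher `D`, with advice `a`, outputs `true`. -/
def accept (D : Data → PMF Data) (k : ℕ) (a : Data) (X : PMF Data) : ℝ :=
  ((X.bind fun s => D (Data.ofList [Data.unary k, a, s])) (Data.ofBool true)).toReal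

/-- Computational indistinguishability of ensembles: the advantage of every probabilistic
polynomial-time distinguisher with polynomial-size advice is negligible. -/
def Indist (X Y : ℕ → PMF Data) : Prop :=
  ∀ D, IsPPT D → ∀ a, PolyBounded a →
    SuperpolynomialDecay atTop (fun k : ℕ => (k : ℝ))
      fun k => |accept D k (a k) (X k) - accept D k (a k) (Y k)|

/-! ## Parties and inputs -/

/-- The server is `none`, the users are `some u`. -/
abbrev Party (n : ℕ) : Type := Option (Fin n)

/-- A table with an entry for the server, followed by one for each user. -/
def ofParty {n : ℕ} (f : Party n → Data) : Data :=
  Data.ofList (f none :: List.ofFn fun u => f (some u))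

/-- The entry of a party in such a table. -/
def Data.at {n : ℕ} (d : Data) : Party n → Data
  | none => d.nth 0
  | some u => d.nth (u + 1)

/-- The number of users, and (as functions of the security parameter) the dimension of the models
and the bound on their entries. -/
structure Params where
  users : ℕ
  dim : ℕ → ℕ
  bound : ℕ → ℕ
  dim_poly : ∃ b : Polynomial ℕ, ∀ k, dim k ≤ b.eval k
  bound_poly : ∃ b : Polynomial ℕ, ∀ k, (bound k).size ≤ b.eval k

/-- The local models of all users, for each value of the security parameter. -/
abbrev Inputs (P : Params) : Type := ∀ k, Fin P.users → Fin (P.dim k) → ℕ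

/-- All entries of the models and of their sum are in the range `[0, bound)`. -/
def Inputs.Valid {P : Params} (x : Inputs P) : Prop :=
  (∀ k u i, x k u i < P.bound k) ∧ ∀ k i, ∑ u, x k u i < P.bound k

/-- The global model: the sum of the models of the participating users `U`. -/
def Inputs.globalModel {P : Params} (x : Inputs P) (U : Finset (Fin P.users)) (k : ℕ) : Data :=
  Data.ofModel fun i => ∑ u ∈ U, x k u i

/-- The encoded models. -/
def Inputs.enc {P : Params} (x : Inputs P) (k : ℕ) (u : Fin P.users) : Data :=
  Data.ofModel (x k u)

/-- The inputs of the corrupted parties `C`: the public data (who is corrupted, who participates,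
the public key), the secret key if the server is corrupted, and the models of the corrupted
users. The pair `key` consists of the public and the secret key. -/
def inputsOf {n : ℕ} (C : Finset (Party n)) (U : Finset (Fin n)) (x : Fin n → Data)
    (key : Data) : Data :=
  Data.ofList [
    ofParty fun p => Data.ofBool (decide (p ∈ C)),
    Data.ofList (List.ofFn fun u => Data.ofBool (decide (u ∈ U))),
    key.fst,
    if none ∈ C then key.snd else Data.nil,
    Data.ofList (List.ofFn fun u => if some u ∈ C then x u else Data.nil)]

/-! ## Encryption and user aggregation -/

/-- A public-key encryption scheme. `gen` maps `1^k` to a pair (public key, secret key), `enc` is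
applied to `[1^k, public key, message]` and `dec` to `[1^k, secret key, ciphertext]`. -/
structure Encryption where
  gen : Data → PMF Data
  gen_ppt : IsPPT gen
  enc : Data → PMF Data
  enc_ppt : IsPPT enc
  dec : Data → Data
  dec_poly : IsPolyFun dec

/-- An aggregation protocol between the users and the server, with a fixed number of synchronous
rounds. `user` and `server` compute the messages that a party sends in a round (a table indexed by
the receivers) from its view up to this round: its inputs, its random bits, and the messages
received so far. `output` computes the aggregated ciphertext from the final view of the server. -/
structure Aggregation where
  rounds : ℕ
  coins : Polynomial ℕ
  user : Data → Data
  user_poly : IsPolyFun user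
  server : Data → Data
  server_poly : IsPolyFun server
  output : Data → Data
  output_poly : IsPolyFun output

namespace Aggregation

variable (G : Aggregation) {n : ℕ}

/-- The view of the server: public data, random bits, messages received (latest round first). -/
def serverView (k : ℕ) (U : Finset (Fin n)) (pk tape : Data) (received : List Data) : Data :=
  Data.ofList [Data.unary k, Data.ofList (List.ofFn fun u => Data.ofBool (decide (u ∈ U))), pk,
    tape, Data.ofList received]

/-- The view of the user `u`. -/
def userView (k : ℕ) (U : Finset (Fin n)) (pk : Data) (u : Fin n) (x tape : Data)
    (received : List Data) : Data :=
  Data.ofList [Data.unary k, Data.ofList (List.ofFn fun u => Data.ofBool (decide (u ∈ U))), pk,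
    Data.ofNat u, x, tape, Data.ofList received]

/-- The messages prescribed by the protocol, as a function of the messages received. A user
outside `U` does not participate. -/
def send (k : ℕ) (U : Finset (Fin n)) (x : Fin n → Data) (pk tapes : Data)
    (received : Party n → List Data) : Party n → Data
  | none => G.server (serverView k U pk (tapes.at (none : Party n)) (received none))
  | some u =>
      if u ∈ U then G.user (userView k U pk u (x u) (tapes.at (some u)) (received (some u)))
      else Data.nil

/-- What the adversary knows at the start: the inputs of the corrupted parties, the random bits of
the server if it is corrupted, and an auxiliary input `z`. -/
def start (C : Finset (Party n)) (U : Finset (Fin n)) (x : Fin n → Data) (key tapes z : Data) :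
    Data :=
  Data.ofList [inputsOf C U x key,
    if none ∈ C then tapes.at (none : Party n) else Data.nil, z]

/-- One round. Corrupted users send whatever the adversary `adv` tells them, after it has seen the
messages of this round from the other parties to the corrupted parties; all other parties, also a
corrupted server, follow the protocol. The state consists of the messages received so far by every
party, and of those seen by the adversary. -/
def round (k : ℕ) (C : Finset (Party n)) (U : Finset (Fin n)) (x : Fin n → Data)
    (key tapes : Data) (adv : Data → Data) (z : Data)
    (s : (Party n → List Data) × List Data) : (Party n → List Data) × List Data :=
  let out := G.send k U x key.fst tapes s.1
  let seen := ofParty fun q : Party n => ofParty fun p : Party n =>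
    if q ∈ C ∧ ¬ (p ∈ C ∧ p ≠ none) then (out p).at q else Data.nil
  let a := adv (Data.ofList [Data.unary k, start C U x key tapes z, Data.ofList (seen :: s.2)])
  (fun q => (ofParty fun p : Party n =>
      if p ∈ C ∧ p ≠ none then (a.at p).at q else (out p).at q) :: s.1 q,
    seen :: s.2)

/-- The state after all rounds. -/
def final (k : ℕ) (C : Finset (Party n)) (U : Finset (Fin n)) (x : Fin n → Data)
    (key tapes : Data) (adv : Data → Data) (z : Data) : (Party n → List Data) × List Data :=
  (G.round k C U x key tapes adv z)^[G.rounds] (fun _ => [], [])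

/-- The aggregated ciphertext obtained by the server. -/
def cipher (k : ℕ) (C : Finset (Party n)) (U : Finset (Fin n)) (x : Fin n → Data)
    (key tapes : Data) (adv : Data → Data) (z : Data) : Data :=
  G.output (serverView k U key.fst (tapes.at (none : Party n))
    ((G.final k C U x key tapes adv z).1 none))

/-- The joint view of the corrupted parties. It contains all the messages received by the server
and the aggregated ciphertext if the server is corrupted. -/
def view (k : ℕ) (C : Finset (Party n)) (U : Finset (Fin n)) (x : Fin n → Data)
    (key tapes : Data) (adv : Data → Data) (z : Data) : Data :=
  Data.ofList [start C U x key tapes z,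
    Data.ofList (G.final k C U x key tapes adv z).2,
    if none ∈ C then
      Data.ofList [Data.ofList ((G.final k C U x key tapes adv z).1 none),
        G.cipher k C U x key tapes adv z]
    else Data.nil]

/-- Independent random bits for the server and all users. -/
def tapes (n k : ℕ) : PMF Data := samples (List.replicate (n + 1) (bits (G.coins.eval k)))

/-- Privacy of the aggregation: the view of the adversary can be simulated from the inputs of the
corrupted parties and an encryption of the sum. -/
def Private (P : Params) (E : Encryption) : Prop :=
  ∀ adv, IsPolyFun adv → ∃ sim, IsPPT sim ∧
    ∀ (C : Finset (Party P.users)) (U : Finset (Fin P.users)) (x : Inputs P), x.Valid →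
    ∀ z, PolyBounded z →
      Indist
        (fun k => (E.gen (Data.unary k)).bind fun key => (G.tapes P.users k).map fun t =>
          G.view k C U (x.enc k) key t adv (z k))
        (fun k => (E.gen (Data.unary k)).bind fun key =>
          (E.enc (Data.ofList [Data.unary k, key.fst, x.globalModel U k])).bind fun c =>
          sim (Data.ofList [Data.unary k, inputsOf C U (x.enc k) key, c, z k]))

end Aggregation

/-! ## Zero-knowledge proofs of attack-free models -/

/-- A two-party protocol with a fixed number of rounds: the verifier sends a challenge, the prover
responds.

`setup` maps `1^k` to the public parameters `pp`; `commit` maps `[1^k, pp, model, r]` to the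
commitment, where `r` consists of random bits; `prover` computes a response from
`[1^k, pp, model, r, random bits, challenges so far]`; `verifier` computes a challenge from
`[1^k, pp, commitment, random bits, responses so far]`; `verdict` maps `[1^k, pp, transcript]` to a
flag which is `nil` if the proof is rejected; `check` maps `[1^k, pp, model, commitments]` to a
flag that tells whether the model is consistent with the list of commitments. -/
structure ZKProof where
  rounds : ℕ
  setup : Data → PMF Data
  setup_ppt : IsPPT setup
  commit : Data → Data
  commit_poly : IsPolyFun commit
  commitCoins : Polynomial ℕ
  prover : Data → Data
  prover_poly : IsPolyFun prover
  proverCoins : Polynomial ℕ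
  verifier : Data → Data
  verifier_poly : IsPolyFun verifier
  verifierCoins : Polynomial ℕ
  verdict : Data → Data
  verdict_poly : IsPolyFun verdict
  check : Data → Data
  check_poly : IsPolyFun check

/-- The challenges and the responses (latest first) of an interaction in which the verifier
computes its challenge from the responses so far, and the prover its response from the challenges
so far. -/
def exchange (V Q : List Data → Data) : ℕ → List Data × List Data
  | 0 => ([], [])
  | i + 1 =>
      let s := exchange V Q i
      (V s.2 :: s.1, Q (V s.2 :: s.1) :: s.2)

namespace ZKProof

variable (Z : ZKProof)

/-- The challenge of a verifier with random bits `t`. -/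
def challenge (k : ℕ) (pp com t : Data) (responses : List Data) : Data :=
  Z.verifier (Data.ofList [Data.unary k, pp, com, t, Data.ofList responses])

/-- The transcript of a session: the commitment, the messages in both directions and the random
bits of the verifier. -/
def record (com : Data) (s : List Data × List Data) (t : Data) : Data :=
  Data.ofList [com, Data.ofList s.1, Data.ofList s.2, t]

/-- The transcript between an honest prover with model `x` and the honest verifier. -/
def transcript (k : ℕ) (pp x : Data) : PMF Data :=
  (bits (Z.commitCoins.eval k)).bind fun r =>
  (bits (Z.proverCoins.eval k)).bind fun w =>
  (bits (Z.verifierCoins.eval k)).map fun t =>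
    let com := Z.commit (Data.ofList [Data.unary k, pp, x, r])
    record com
      (exchange (Z.challenge k pp com t)
        (fun cs => Z.prover (Data.ofList [Data.unary k, pp, x, r, w, Data.ofList cs])) Z.rounds) t

/-- Zero knowledge: the transcript between an honest prover whose model is attack-free and the
honest verifier can be simulated from the public parameters. -/
def ZeroKnowledge (P : Params) (clean : ∀ k, (Fin (P.dim k) → ℕ) → Prop) : Prop :=
  ∃ sim, IsPPT sim ∧
    ∀ x : ∀ k, Fin (P.dim k) → ℕ, (∀ k i, x k i < P.bound k) → (∀ k, clean k (x k)) →
      Indist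
        (fun k => (Z.setup (Data.unary k)).bind fun pp =>
          (Z.transcript k pp (Data.ofModel (x k))).map fun t => Data.ofList [pp, t])
        (fun k => (Z.setup (Data.unary k)).bind fun pp =>
          (sim (Data.ofList [Data.unary k, pp])).map fun t => Data.ofList [pp, t])

end ZKProof

/-! ## The framework -/

/-- A strategy for the corrupted users in the sessions with the verifier and in the aggregation,
and the number of its random bits. -/
structure Adversary where
  coins : Polynomial ℕ
  zk : Data → Data
  zk_poly : IsPolyFun zk
  agg : Data → Data
  agg_poly : IsPolyFun agg

namespace Framework

variable {n : ℕ} (E : Encryption) (G : Aggregation) (Z : ZKProof) (adv : Adversary)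

/-- The transcripts of the sessions of all participating users that are not corrupted. -/
def honestSessions (k : ℕ) (C : Finset (Party n)) (U : Finset (Fin n)) (x : Fin n → Data)
    (pp : Data) : PMF Data :=
  samples (List.ofFn fun u =>
    if u ∈ U ∧ some u ∉ C then Z.transcript k pp (x u) else PMF.pure Data.nil)

/-- What the adversary knows at the start: the inputs of the corrupted parties, the public
parameters, an auxiliary input `z`, its random bits `w`, and, if the server is corrupted, the
transcripts `ts` of the other users and the random bits `vs` of the verifier in the sessions with
the corrupted users. -/
def start (C : Finset (Party n)) (U : Finset (Fin n)) (x : Fin n → Data)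
    (key pp z w ts vs : Data) : Data :=
  Data.ofList [inputsOf C U x key, pp, z, w,
    if none ∈ C then ts else Data.nil, if none ∈ C then vs else Data.nil]

/-- The commitments of the corrupted users (a list indexed by the users), chosen by the
adversary. -/
def commitments (k : ℕ) (s : Data) : Data :=
  adv.zk (Data.ofList [Data.unary k, s, Data.nil])

/-- The sessions of the corrupted users with the verifier, which run in parallel: in each round
the adversary obtains the list of challenges and answers with a list of responses. -/
def corruptSessions (k : ℕ) (C : Finset (Party n)) (pp vs s : Data) : List Data × List Data :=
  exchange
    (fun rs => Data.ofList (List.ofFn fun u : Fin n =>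
      if some u ∈ C then
        Z.challenge k pp ((commitments adv k s).nth u) (vs.nth u) (rs.map fun r => r.nth u)
      else Data.nil))
    (fun cs => adv.zk (Data.ofList [Data.unary k, s, Data.ofList cs]))
    Z.rounds

/-- The transcripts obtained by the server from all users. -/
def sessions (k : ℕ) (C : Finset (Party n)) (pp ts vs s : Data) (u : Fin n) : Data :=
  if some u ∈ C then
    ZKProof.record ((commitments adv k s).nth u)
      ((corruptSessions Z adv k C pp vs s).1.map fun c => c.nth u,
        (corruptSessions Z adv k C pp vs s).2.map fun r => r.nth u) (vs.nth u)
  else ts.nth u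

/-- The computation of the global model by the server, from the transcripts `tr` and the
aggregated ciphertext `c`: it validates the proofs, decrypts the ciphertext, and compares the
result with the commitments whose proofs are valid. -/
def compute (k : ℕ) (pp sk : Data) (tr : Fin n → Data) (c : Data) : Data :=
  let valid := fun u => Z.verdict (Data.ofList [Data.unary k, pp, tr u])
  let model := E.dec (Data.ofList [Data.unary k, sk, c])
  Data.ofList [Data.ofList (List.ofFn valid), model,
    Z.check (Data.ofList [Data.unary k, pp, model,
      Data.ofList (List.ofFn fun u => (valid u).keep ((tr u).nth 0))])]

/-- The joint view of the corrupted parties `C` in an execution of the framework with participating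
users `U`, models `x` and auxiliary input `z`: the sessions of the zero-knowledge proof, the
aggregation, and, if the server is corrupted, its computation of the global model. -/
def view (k : ℕ) (C : Finset (Party n)) (U : Finset (Fin n)) (x : Fin n → Data) (z : Data) :
    PMF Data :=
  (Z.setup (Data.unary k)).bind fun pp =>
  (E.gen (Data.unary k)).bind fun key =>
  (bits (adv.coins.eval k)).bind fun w =>
  (honestSessions Z k C U x pp).bind fun ts =>
  (samples (List.replicate n (bits (Z.verifierCoins.eval k)))).bind fun vs =>
  (G.tapes n k).map fun t =>
    let s := start C U x key pp z w ts vs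
    let aux := Data.ofList [s, Data.ofList (corruptSessions Z adv k C pp vs s).1]
    Data.ofList [G.view k C U x key t adv.agg aux,
      if none ∈ C then
        compute E Z k pp key.snd (sessions Z adv k C pp ts vs s)
          (G.cipher k C U x key t adv.agg aux)
      else Data.nil]

end Framework

end FL

end

open FL

noncomputable section

namespace FL

/-! The proof passes through one intermediate experiment: the sessions of the honest provers are
real, while the aggregation is already simulated.

From the real view to the intermediate one. Apart from the aggregation, the randomness of an
execution consists of the public parameters, the coins of the adversary, the honest transcripts and
the coins of the verifier. Together with the auxiliary input they form the `resources`, which are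
independent of the keys and of the aggregation tapes. Once they are fixed, everything outside the
aggregation is a deterministic polynomial-time function of the resources, the inputs of the
corrupted parties and the aggregation view. So the framework's view is `complete` applied to the
view of a pure aggregation in which the strategy `aggStrategy` has the resources as auxiliary input
(`complete_view`, `view_eq`). Privacy of the aggregation holds for every auxiliary input of
polynomial size, hence also for random resources: an average advantage is at most the advantage at
some fixed outcome (`Indist.average`). It does not matter that the resources depend on honest
models, because advice need not be computable.

From the intermediate view to the simulator. The honest transcripts are replaced by simulated ones,
user by user (`indist_hybridSessions`). Each replacement is an instance of zero knowledge, since a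
distinguisher with the models as advice can produce all the rest: the other sessions, the keys, an
encryption of the global model and the simulated aggregation (`indist_view`). The final experiment
uses honest models only through their sum.

The remaining work shows that all these reductions are polynomial-time programs. -/

lemma eval_mono_nat (b : Polynomial ℕ) {i j : ℕ} (h : i ≤ j) : b.eval i ≤ b.eval j := by
  simp only [Polynomial.eval_eq_sum_range]
  gcongr

/-! ### Running times -/

lemma iterate_size_le {f : Data → PMF (Data × ℕ)}
    (hf : ∀ d, ∀ r ∈ (f d).support, r.1.size ≤ r.2) :
    ∀ i (s : Data × ℕ), s.1.size ≤ s.2 → ∀ r ∈ (iterate f i s).support, r.1.size ≤ r.2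
  | 0, s, hs, r, hr => by
      simp only [iterate, PMF.support_pure, Set.mem_singleton_iff] at hr
      exact hr ▸ hs
  | i + 1, s, hs, r, hr => by
      simp only [iterate, PMF.mem_support_bind_iff] at hr
      obtain ⟨a, ha, hr⟩ := hr
      have := hf _ a ha
      exact iterate_size_le hf i _ (by simp only; omega) r hr

/-- Every elementary step is charged at least the size of its result. This keeps compositions
polynomial: the second program receives an input no larger than the time spent by the first, so time
bounds compose as polynomials. -/
lemma Prog.size_le_time (p : Prog) : ∀ d, ∀ r ∈ (p.run d).support, r.1.size ≤ r.2 := by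
  induction p with
  | nil | id => intro d r hr; simp_all [Prog.run, Data.size]
  | fst =>
    intro d r hr
    simp only [Prog.run, PMF.support_pure, Set.mem_singleton_iff] at hr
    subst hr; cases d <;> simp [Data.fst, Data.size]; omega
  | snd =>
    intro d r hr
    simp only [Prog.run, PMF.support_pure, Set.mem_singleton_iff] at hr
    subst hr; cases d <;> simp [Data.snd, Data.size]; omega
  | coin =>
    intro d r hr
    simp only [Prog.run, PMF.support_map, Set.mem_image] at hr
    obtain ⟨b, -, rfl⟩ := hr
    cases b <;> simp [Data.ofBool, Data.size]
  | pair f g hf hg =>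
    intro d r hr
    simp only [Prog.run, PMF.mem_support_bind_iff, PMF.support_map, Set.mem_image] at hr
    obtain ⟨a, ha, b, hb, rfl⟩ := hr
    have := hf _ _ ha
    have := hg _ _ hb
    simp only [Data.size]; omega
  | comp g f hg hf =>
    intro d r hr
    simp only [Prog.run, PMF.mem_support_bind_iff, PMF.support_map, Set.mem_image] at hr
    obtain ⟨a, ha, b, hb, rfl⟩ := hr
    have := hg _ _ hb
    simp only; omega
  | ite c f g hc hf hg =>
    intro d r hr
    simp only [Prog.run, PMF.mem_support_bind_iff] at hr
    obtain ⟨⟨a, t⟩, ha, hr⟩ := hr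
    cases a <;> simp only [PMF.support_map, Set.mem_image] at hr <;> obtain ⟨b, hb, rfl⟩ := hr
    · have := hg _ _ hb
      simp only; omega
    · have := hf _ _ hb
      simp only; omega
  | loop c f hc hf =>
    intro d r hr
    simp only [Prog.run, PMF.mem_support_bind_iff] at hr
    obtain ⟨a, ha, hr⟩ := hr
    exact iterate_size_le hf _ _ (by simp only; omega) r hr

lemma IsPPT.size_le {f : Data → PMF Data} (hf : IsPPT f) :
    ∃ b : Polynomial ℕ, ∀ d, ∀ r ∈ (f d).support, r.size ≤ b.eval d.size := by
  obtain ⟨p, ⟨b, hb⟩, hp⟩ := hf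
  refine ⟨b, fun d r hr => ?_⟩
  rw [← hp, PMF.support_map] at hr
  obtain ⟨a, ha, rfl⟩ := hr
  exact (p.size_le_time d a ha).trans (hb d a ha)

/-! ### Closure properties of probabilistic polynomial-time algorithms -/

lemma isPPT_nil : IsPPT fun _ => PMF.pure Data.nil :=
  ⟨.nil, ⟨1, fun d r hr => by simp_all [Prog.run]⟩, fun d => by simp [Prog.run, PMF.pure_map]⟩

lemma isPPT_id : IsPPT PMF.pure :=
  ⟨.id, ⟨Polynomial.X + 1, fun d r hr => by simp_all [Prog.run]⟩,
    fun d => by simp [Prog.run, PMF.pure_map]⟩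

lemma isPPT_fst : IsPPT fun d => PMF.pure d.fst :=
  ⟨.fst, ⟨Polynomial.X + 1, fun d r hr => by simp_all [Prog.run]⟩,
    fun d => by simp [Prog.run, PMF.pure_map]⟩

lemma isPPT_snd : IsPPT fun d => PMF.pure d.snd :=
  ⟨.snd, ⟨Polynomial.X + 1, fun d r hr => by simp_all [Prog.run]⟩,
    fun d => by simp [Prog.run, PMF.pure_map]⟩

lemma IsPPT.cons {f g : Data → PMF Data} (hf : IsPPT f) (hg : IsPPT g) :
    IsPPT fun d => (f d).bind fun a => (g d).map (Data.cons a) := by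
  obtain ⟨p, ⟨b, hb⟩, hp⟩ := hf
  obtain ⟨q, ⟨c, hc⟩, hq⟩ := hg
  refine ⟨.pair p q, ⟨b + c + 1, fun d r hr => ?_⟩, fun d => ?_⟩
  · simp only [Prog.run, PMF.mem_support_bind_iff, PMF.support_map, Set.mem_image] at hr
    obtain ⟨u, hu, v, hv, rfl⟩ := hr
    have := hb _ _ hu
    have := hc _ _ hv
    simp; omega
  · simp only [Prog.run, ← hp, ← hq, PMF.map_bind, PMF.bind_map, PMF.map_comp]
    rfl

lemma IsPPT.bind {f g : Data → PMF Data} (hf : IsPPT f) (hg : IsPPT g) :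
    IsPPT fun d => (f d).bind g := by
  obtain ⟨p, ⟨b, hb⟩, hp⟩ := hf
  obtain ⟨q, ⟨c, hc⟩, hq⟩ := hg
  refine ⟨.comp q p, ⟨b + c.comp b + 1, fun d r hr => ?_⟩, fun d => ?_⟩
  · simp only [Prog.run, PMF.mem_support_bind_iff, PMF.support_map, Set.mem_image] at hr
    obtain ⟨u, hu, v, hv, rfl⟩ := hr
    have h1 := hb _ _ hu
    have h2 := hc _ _ hv
    have h3 := eval_mono_nat c ((p.size_le_time _ _ hu).trans h1)
    simp only [Polynomial.eval_add, Polynomial.eval_comp, Polynomial.eval_one]; omega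
  · simp only [Prog.run, ← hp, PMF.map_bind, PMF.bind_map, PMF.map_comp]
    congr 1; funext a
    exact hq a.1

/-- Branching on whether a tree is `nil`. -/
def Data.branch {α : Type*} (c : Data) (x y : α) : α :=
  match c with
  | nil => y
  | cons _ _ => x

lemma IsPPT.branch {f g h : Data → PMF Data} (hf : IsPPT f) (hg : IsPPT g) (hh : IsPPT h) :
    IsPPT fun d => (h d).bind fun c => c.branch (f d) (g d) := by
  obtain ⟨p, ⟨b, hb⟩, hp⟩ := hf
  obtain ⟨q, ⟨c, hc⟩, hq⟩ := hg
  obtain ⟨s, ⟨e, he⟩, hs⟩ := hh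
  refine ⟨.ite s p q, ⟨b + c + e + 1, fun d r hr => ?_⟩, fun d => ?_⟩
  · simp only [Prog.run, PMF.mem_support_bind_iff] at hr
    obtain ⟨⟨a, t⟩, ha, hr⟩ := hr
    have h1 := he _ _ ha
    cases a <;> simp only [PMF.support_map, Set.mem_image] at hr <;> obtain ⟨v, hv, rfl⟩ := hr
    · have := hc _ _ hv
      simp at h1 ⊢; omega
    · have := hb _ _ hv
      simp at h1 ⊢; omega
  · simp only [Prog.run, ← hp, ← hq, ← hs, PMF.map_bind, PMF.bind_map]
    congr 1; funext ⟨a, t⟩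
    cases a <;> simp only [PMF.map_comp, Data.branch, Function.comp_apply] <;> rfl

/-- `IsPPT.bind` for a continuation that also depends on the input. -/
lemma IsPPT.bind_with {f : Data → PMF Data} {g : Data → Data → PMF Data} (hf : IsPPT f)
    (hg : IsPPT fun e => g e.fst e.snd) : IsPPT fun d => (f d).bind (g d) := by
  have := (isPPT_id.cons hf).bind hg
  simpa [PMF.pure_bind, PMF.bind_map, Function.comp_def, Data.fst, Data.snd] using this

/-! ### Counting loops -/

/-- Put `j` independent samples of `μ` in front of a list. -/
def pushes (μ : PMF Data) : ℕ → Data → PMF Data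
  | 0, acc => PMF.pure acc
  | j + 1, acc => μ.bind fun b => pushes μ j (Data.cons b acc)

lemma pushes_add (μ : PMF Data) (i j : ℕ) (acc : Data) :
    pushes μ (i + j) acc = (pushes μ i acc).bind (pushes μ j) := by
  induction i generalizing acc with
  | zero => simp [pushes, PMF.pure_bind]
  | succ i ih => rw [Nat.add_right_comm]; simp [pushes, ih, PMF.bind_bind]

/-- The sample pushed last is the head of the list, so splitting it off with `pushes_add` gives the
recursion by which `bits` is defined. Independence allows it to be drawn first. -/
lemma pushes_succ (μ : PMF Data) (j : ℕ) (acc : Data) :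
    pushes μ (j + 1) acc = μ.bind fun b => (pushes μ j acc).map (Data.cons b) := by
  rw [pushes_add, show pushes μ 1 = fun a => μ.map fun b => Data.cons b a from rfl]
  simp only [PMF.map, Function.comp_def]
  rw [PMF.bind_comm]

lemma pushes_size_le {μ : PMF Data} (hμ : ∀ b ∈ μ.support, b.size ≤ 3) (j : ℕ) (acc : Data) :
    ∀ r ∈ (pushes μ j acc).support, r.size ≤ acc.size + 4 * j := by
  induction j generalizing acc with
  | zero => simp [pushes]
  | succ j ih =>
    intro r hr
    simp only [pushes, PMF.mem_support_bind_iff] at hr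
    obtain ⟨b, hb, hr⟩ := hr
    have := ih _ r hr
    have := hμ b hb
    simp only [Data.size] at *; omega

/-- Looping a polynomial-time body need not take polynomial time, since the data may grow in every
pass. The invariant `I i` carries the size bound after `i` passes that yields a uniform time bound
`T` per pass. -/
lemma iterate_time_le {f : Data → PMF (Data × ℕ)} (I : ℕ → Data → Prop) (T N : ℕ)
    (hf : ∀ i < N, ∀ d, I i d → ∀ r ∈ (f d).support, I (i + 1) r.1 ∧ r.2 ≤ T) :
    ∀ n i (s : Data × ℕ), i + n = N → I i s.1 → ∀ r ∈ (iterate f n s).support,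
      r.2 ≤ s.2 + n * (T + 1)
  | 0, i, s, _, _, r, hr => by
      simp only [iterate, PMF.support_pure, Set.mem_singleton_iff] at hr
      simp [hr]
  | n + 1, i, s, hn, hs, r, hr => by
      simp only [iterate, PMF.mem_support_bind_iff] at hr
      obtain ⟨a, ha, hr⟩ := hr
      obtain ⟨h1, h2⟩ := hf i (by omega) _ hs a ha
      have := iterate_time_le I T N hf n (i + 1) (a.1, s.2 + a.2 + 1) (by omega) h1 r hr
      simp only at this
      rw [Nat.succ_mul]; omega

lemma IsPPT.congr {f g : Data → PMF Data} (hf : IsPPT f) (h : ∀ d, f d = g d) : IsPPT g := by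
  rwa [show g = f from funext fun d => (h d).symm]

/-- Map a pair `(acc, e)` to the pair that has `n` samples of `μ` in front of `acc`, where `n` is the
value of the polynomial `P` at the length of `e`. -/
def pushFun (μ : PMF Data) (P : Polynomial ℕ) (d : Data) : PMF Data :=
  (pushes μ (P.eval d.snd.length) d.fst).map fun acc => Data.cons acc d.snd

@[simp] lemma fst_cons (a b : Data) : (Data.cons a b).fst = a := rfl

@[simp] lemma snd_cons (a b : Data) : (Data.cons a b).snd = b := rfl

lemma length_le_size (d : Data) : d.length ≤ d.size := by
  induction d with
  | nil => simp [Data.length]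
  | cons a b _ ih => simp only [Data.length, Data.size]; omega

lemma snd_size_le (d : Data) : d.snd.size ≤ d.size := by
  cases d <;> simp only [Data.snd, Data.size] <;> omega

lemma iterate_map_fst (f : Data → PMF (Data × ℕ)) (n : ℕ) (d : Data) (t t' : ℕ) :
    (iterate f n (d, t)).map Prod.fst = (iterate f n (d, t')).map Prod.fst := by
  induction n generalizing d t t' with
  | zero => simp [iterate, PMF.pure_map]
  | succ n ih =>
    simp only [iterate, PMF.map_bind]
    congr 1; funext r; exact ih _ _ _

/-- The body leaves the counter `e` untouched, so every pass pushes the same number of samples. -/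
lemma iterate_pushes {p : Prog} {μ : PMF Data} {P : Polynomial ℕ}
    (hp : ∀ d, (p.run d).map Prod.fst = pushFun μ P d) (e : Data) :
    ∀ n acc t, (iterate p.run n (Data.cons acc e, t)).map Prod.fst =
      (pushes μ (n * P.eval e.length) acc).map fun acc => Data.cons acc e
  | 0, acc, t => by simp [iterate, pushes, PMF.pure_map]
  | n + 1, acc, t => by
      have key : ∀ s : Data × ℕ, (iterate p.run n s).map Prod.fst =
          (iterate p.run n (s.1, 0)).map Prod.fst :=
        fun s => iterate_map_fst _ n s.1 s.2 0
      simp only [iterate, PMF.map_bind]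
      have : (fun r : Data × ℕ => (iterate p.run n (r.1, t + r.2 + 1)).map Prod.fst) =
          (fun d => (iterate p.run n (d, 0)).map Prod.fst) ∘ Prod.fst := by
        funext r; exact key _
      rw [this, ← PMF.bind_map, hp, pushFun, PMF.bind_map, Nat.succ_mul, Nat.add_comm, pushes_add,
        PMF.map_bind]
      simp only [Data.fst, Data.snd, Function.comp_def, iterate_pushes hp e n]

/-- A loop over the counter repeats the body once per entry, which multiplies the count by `X`.
Growth is additive: each sample adds at most its size 3 and one node, hence the factor 4 below. -/
lemma isPPT_pushFun_loop {μ : PMF Data} (hμ : ∀ b ∈ μ.support, b.size ≤ 3) {P : Polynomial ℕ}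
    (h : IsPPT (pushFun μ P)) : IsPPT (pushFun μ (Polynomial.X * P)) := by
  obtain ⟨p, ⟨b, hb⟩, hp⟩ := h
  -- The loop has to start from a genuine pair: on `nil` it makes no pass and would return `nil`
  -- instead of `cons nil nil`.
  have h0 : IsPPT fun d => PMF.pure (Data.cons d.fst d.snd) := by
    simpa [PMF.pure_bind, PMF.pure_map] using isPPT_fst.cons isPPT_snd
  obtain ⟨q, ⟨c, hc⟩, hq⟩ := h0
  -- the state after the normalization of the input to a pair
  have inv : ∀ d, ∀ r ∈ (q.run d).support, r.1 = Data.cons d.fst d.snd := by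
    intro d r hr
    have : r.1 ∈ ((q.run d).map Prod.fst).support := by
      rw [PMF.support_map]; exact ⟨r, hr, rfl⟩
    simpa [hq] using this
  -- Bounds the state in all passes. The summand 2 is the cost of turning `nil`, of size 1, into a
  -- pair of size 3.
  let S : Polynomial ℕ := Polynomial.X + 2 + 4 * Polynomial.X * P
  refine ⟨.comp (.loop .snd p) q, ⟨c + (2 * Polynomial.X + 8) +
    Polynomial.X * (b.comp S + 1), fun d r hr => ?_⟩, fun d => ?_⟩
  · simp only [Prog.run, PMF.mem_support_bind_iff, PMF.support_map, Set.mem_image,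
      PMF.pure_bind] at hr
    obtain ⟨u, hu, v, hv, rfl⟩ := hr
    have h1 := hc _ _ hu
    have h2 := inv _ _ hu
    have hsize : u.1.size ≤ d.size + 2 := by
      rw [h2]; cases d <;> simp only [Data.fst, Data.snd, Data.size] <;> omega
    have hsnd : u.1.snd.length ≤ d.size := by
      rw [h2]; exact (length_le_size _).trans (snd_size_le d)
    have hu2 : u.2 ≤ c.eval d.size := h1
    obtain ⟨u1, u2⟩ := u
    simp only at hsnd hsize hv hu2
    clear h1 h2 hu
    generalize hE : u1.snd = e at hsnd hv
    have := iterate_time_le (f := p.run)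
      (fun i s => s.snd = e ∧ s.size ≤ u1.size + 4 * (i * P.eval e.length))
      ((b.comp S).eval d.size) e.length ?_ e.length 0 (_, _) (by simp) ⟨hE, by simp⟩ v hv
    · have hm := Nat.mul_le_mul_right ((b.comp S).eval d.size + 1) hsnd
      simp only [Polynomial.eval_add, Polynomial.eval_mul, Polynomial.eval_X,
        Polynomial.eval_ofNat, Polynomial.eval_one] at hm ⊢
      simp only at this
      omega
    · intro i hi s ⟨hs1, hs2⟩ r hr
      have hmul : 4 * (i * P.eval e.length) ≤ 4 * d.size * P.eval d.size := by
        rw [mul_assoc]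
        exact Nat.mul_le_mul_left _ (Nat.mul_le_mul (by omega) (eval_mono_nat P hsnd))
      have hr1 : r.1 ∈ ((p.run s).map Prod.fst).support := by
        rw [PMF.support_map]; exact ⟨r, hr, rfl⟩
      rw [hp, pushFun, PMF.support_map] at hr1
      obtain ⟨acc, hacc, hr1⟩ := hr1
      have hacc := pushes_size_le hμ _ _ _ hacc
      rw [← hr1]
      refine ⟨⟨hs1, ?_⟩, ?_⟩
      · cases s with
        | nil =>
          rw [← hs1] at hi
          simp [Data.length, Data.snd] at hi
        | cons s1 s2 =>
          simp only [Data.snd, Data.fst, Data.size] at hs1 hs2 hacc ⊢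
          rw [hs1] at hacc hs2 ⊢
          rw [Nat.succ_mul i]
          omega
      · refine (hb _ _ hr).trans ?_
        rw [Polynomial.eval_comp]
        apply eval_mono_nat
        simp only [S, Polynomial.eval_add, Polynomial.eval_mul, Polynomial.eval_X,
          Polynomial.eval_ofNat]
        omega
  · simp only [Prog.run, PMF.map_bind, PMF.pure_bind, PMF.map_comp]
    have e : ∀ (a : Data × ℕ) t, (iterate p.run a.1.snd.length (a.1, t)).map
        (Prod.fst ∘ fun b : Data × ℕ => (b.1, a.2 + b.2 + 1)) =
        (iterate p.run a.1.snd.length (a.1, 0)).map Prod.fst :=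
      fun a t => iterate_map_fst _ _ _ _ _
    simp only [e]
    rw [show (fun a : Data × ℕ => (iterate p.run a.1.snd.length (a.1, 0)).map Prod.fst) =
      (fun d => (iterate p.run d.snd.length (d, 0)).map Prod.fst) ∘ Prod.fst from rfl,
      ← PMF.bind_map, hq, PMF.pure_bind]
    rw [snd_cons, iterate_pushes hp]
    simp [pushFun]

/-- Polynomials arise from constants by addition and multiplication by `X`. On programs these are
repeated pushing, composition and a loop. -/
lemma isPPT_pushFun {μ : PMF Data} (hμ : ∀ b ∈ μ.support, b.size ≤ 3) (h : IsPPT fun _ => μ)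
    (P : Polynomial ℕ) : IsPPT (pushFun μ P) := by
  have h0 : ∀ c : ℕ, IsPPT (pushFun μ (Polynomial.C c)) := by
    intro c
    induction c with
    | zero =>
      refine (isPPT_fst.cons isPPT_snd).congr fun d => ?_
      simp [pushFun, pushes, PMF.pure_map, PMF.pure_bind]
    | succ c ih =>
      refine (ih.bind ((h.cons isPPT_fst).cons isPPT_snd)).congr fun d => ?_
      simp only [pushFun, Polynomial.eval_C, pushes_succ, PMF.map, PMF.pure_bind, PMF.bind_bind,
        Function.comp_apply, Data.fst, Data.snd]
      rw [PMF.bind_comm]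
  induction P using Polynomial.induction_on' with
  | add P Q hP hQ =>
    refine (hP.bind hQ).congr fun d => ?_
    simp only [pushFun, Polynomial.eval_add, pushes_add, PMF.bind_map, PMF.map_bind]
    rfl
  | monomial n c =>
    induction n with
    | zero => exact h0 c
    | succ n ih =>
      rw [← Polynomial.X_mul_monomial]
      exact isPPT_pushFun_loop hμ ih

lemma isPPT_pushes {μ : PMF Data} (hμ : ∀ b ∈ μ.support, b.size ≤ 3) (h : IsPPT fun _ => μ)
    (P : Polynomial ℕ) : IsPPT fun d => pushes μ (P.eval d.length) Data.nil := by
  refine ((isPPT_nil.cons isPPT_id).bind ((isPPT_pushFun hμ h P).bind isPPT_fst)).congr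
    fun d => ?_
  simp only [PMF.pure_bind, PMF.pure_map, pushFun, Data.fst, Data.snd, PMF.bind_map]
  exact PMF.bind_pure _

lemma isPPT_coin : IsPPT fun _ => (PMF.uniformOfFintype Bool).map Data.ofBool :=
  ⟨.coin, ⟨3, fun d r hr => by
    simp only [Prog.run, PMF.support_map, Set.mem_image] at hr
    obtain ⟨b, -, rfl⟩ := hr
    simp⟩, fun d => by simp only [Prog.run, PMF.map_comp]; rfl⟩

lemma bits_eq_pushes (l : ℕ) :
    bits l = pushes ((PMF.uniformOfFintype Bool).map Data.ofBool) l Data.nil := by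
  induction l with
  | zero => rfl
  | succ l ih => rw [pushes_succ, bits, PMF.bind_map, ih]; rfl

lemma isPPT_bits (P : Polynomial ℕ) : IsPPT fun d => bits (P.eval d.length) := by
  simp only [bits_eq_pushes]
  refine isPPT_pushes (fun b hb => ?_) isPPT_coin P
  rw [PMF.support_map] at hb
  obtain ⟨b, -, rfl⟩ := hb
  cases b <;> simp [Data.ofBool, Data.size]

lemma unary_succ (k : ℕ) : Data.unary (k + 1) = Data.cons Data.nil (Data.unary k) := rfl

@[simp] lemma length_unary (k : ℕ) : (Data.unary k).length = k := by
  induction k with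
  | zero => rfl
  | succ k ih => rw [unary_succ, Data.length, ih]

lemma pushes_nil (l : ℕ) : pushes (PMF.pure Data.nil) l Data.nil = PMF.pure (Data.unary l) := by
  induction l with
  | zero => rfl
  | succ l ih => rw [pushes_succ, ih, PMF.pure_bind, PMF.pure_map, unary_succ]

/-- Algorithms know the security parameter only as the length of an input entry. This lemma lets `k`
be replaced by such a length in all polynomial-time claims below. -/
lemma isPolyFun_unary_length : IsPolyFun fun d => Data.unary d.length := by
  refine (isPPT_pushes (μ := PMF.pure Data.nil) (by simp [Data.size]) isPPT_nil
    Polynomial.X).congr fun d => ?_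
  rw [pushes_nil, Polynomial.eval_X]

/-! ### Closure properties of polynomial-time functions -/

lemma IsPPT.comp {f : Data → PMF Data} {g : Data → Data} (hf : IsPPT f) (hg : IsPolyFun g) :
    IsPPT fun d => f (g d) := by
  simpa [PMF.pure_bind] using IsPPT.bind hg hf

attribute [fun_prop] IsPolyFun

namespace IsPolyFun

@[fun_prop]
lemma id : IsPolyFun fun d => d := isPPT_id

@[fun_prop]
lemma comp {f g : Data → Data} (hf : IsPolyFun f) (hg : IsPolyFun g) :
    IsPolyFun fun d => f (g d) :=
  IsPPT.comp (f := fun d => PMF.pure (f d)) hf hg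

@[fun_prop]
lemma cons {f g : Data → Data} (hf : IsPolyFun f) (hg : IsPolyFun g) :
    IsPolyFun fun d => Data.cons (f d) (g d) := by
  simpa [PMF.pure_bind, PMF.pure_map, IsPolyFun] using IsPPT.cons hf hg

@[fun_prop]
lemma const (a : Data) : IsPolyFun fun _ => a := by
  induction a with
  | nil => exact isPPT_nil
  | cons a b ha hb => exact ha.cons hb

@[fun_prop]
lemma fst {f : Data → Data} (hf : IsPolyFun f) : IsPolyFun fun d => (f d).fst :=
  comp (f := Data.fst) isPPT_fst hf

@[fun_prop]
lemma snd {f : Data → Data} (hf : IsPolyFun f) : IsPolyFun fun d => (f d).snd :=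
  comp (f := Data.snd) isPPT_snd hf

@[fun_prop]
lemma nth {f : Data → Data} (hf : IsPolyFun f) (i : ℕ) : IsPolyFun fun d => (f d).nth i := by
  induction i generalizing f with
  | zero => exact hf.fst
  | succ i ih => exact ih hf.snd

@[fun_prop]
lemma unary_length {f : Data → Data} (hf : IsPolyFun f) :
    IsPolyFun fun d => Data.unary (f d).length :=
  comp (f := fun d => Data.unary d.length) isPolyFun_unary_length hf

@[fun_prop]
lemma branch {c f g : Data → Data} (hc : IsPolyFun c) (hf : IsPolyFun f) (hg : IsPolyFun g) :
    IsPolyFun fun d => (c d).branch (f d) (g d) := by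
  refine (IsPPT.branch hf hg hc).congr fun d => ?_
  rw [PMF.pure_bind]
  cases h : c d <;> simp [h, Data.branch]

@[fun_prop]
lemma keep {c f : Data → Data} (hc : IsPolyFun c) (hf : IsPolyFun f) :
    IsPolyFun fun d => (c d).keep (f d) := by
  have := branch hc hf (const Data.nil)
  convert this using 2 with d
  cases c d <;> rfl

end IsPolyFun

/-- Functions that compute in polynomial time the entries of a list of constant length. -/
def PolyList (L : Data → List Data) : Prop :=
  ∃ l : List (Data → Data), (∀ f ∈ l, IsPolyFun f) ∧ ∀ d, L d = l.map fun f => f d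

namespace PolyList

lemma nil : PolyList fun _ => [] := ⟨[], by simp, by simp⟩

lemma cons {f : Data → Data} {L : Data → List Data} (hf : IsPolyFun f) (hL : PolyList L) :
    PolyList fun d => f d :: L d := by
  obtain ⟨l, hl, h⟩ := hL
  exact ⟨f :: l, by simpa using ⟨hf, hl⟩, fun d => by simp [h]⟩

lemma ofFn {n : ℕ} {f : Fin n → Data → Data} (hf : ∀ u, IsPolyFun (f u)) :
    PolyList fun d => List.ofFn fun u => f u d :=
  ⟨List.ofFn f, by simpa [List.mem_ofFn], fun d => by simp [List.map_ofFn, Function.comp_def]⟩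

lemma map {L : Data → List Data} {g : Data → Data} (hL : PolyList L) (hg : IsPolyFun g) :
    PolyList fun d => (L d).map g := by
  obtain ⟨l, hl, h⟩ := hL
  refine ⟨l.map fun f d => g (f d), ?_, fun d => by simp [h]⟩
  intro _ hf
  obtain ⟨f, hfl, rfl⟩ := List.mem_map.1 hf
  exact hg.comp (hl f hfl)

@[fun_prop]
lemma ofList {L : Data → List Data} (hL : PolyList L) : IsPolyFun fun d => Data.ofList (L d) := by
  obtain ⟨l, hl, h⟩ := hL
  simp only [h]
  clear h
  induction l with
  | nil => exact .const _
  | cons f l ih =>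
    simp only [List.mem_cons, forall_eq_or_imp] at hl
    exact hl.1.cons (ih hl.2)

/-- The number `i` of rounds does not depend on the input, so the interaction unrolls into a fixed
composition of polynomial-time functions. -/
lemma exchange {V Q : Data → List Data → Data}
    (hV : ∀ L, PolyList L → IsPolyFun fun d => V d (L d))
    (hQ : ∀ L, PolyList L → IsPolyFun fun d => Q d (L d)) (i : ℕ) :
    (PolyList fun d => (exchange (V d) (Q d) i).1) ∧
      PolyList fun d => (FL.exchange (V d) (Q d) i).2 := by
  induction i with
  | zero => exact ⟨nil, nil⟩
  | succ i ih =>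
    have h := cons (hV _ ih.2) ih.1
    exact ⟨h, cons (hQ _ h) ih.2⟩

end PolyList

@[fun_prop]
lemma IsPolyFun.ofFn {n : ℕ} {f : Fin n → Data → Data} (hf : ∀ u, IsPolyFun (f u)) :
    IsPolyFun fun d => Data.ofList (List.ofFn fun u => f u d) := (PolyList.ofFn hf).ofList

/-! ### Closure properties of probabilistic algorithms -/

lemma IsPPT.map_with {f : Data → PMF Data} {g : Data → Data → Data} (hf : IsPPT f)
    (hg : IsPolyFun fun e => g e.fst e.snd) : IsPPT fun d => (f d).map (g d) :=
  hf.bind_with (g := fun d a => PMF.pure (g d a)) hg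

lemma isPPT_samples (l : List (Data → PMF Data)) (hl : ∀ f ∈ l, IsPPT f) :
    IsPPT fun d => samples (l.map fun f => f d) := by
  induction l with
  | nil => exact isPPT_nil
  | cons f l ih =>
    simp only [List.mem_cons, forall_eq_or_imp] at hl
    exact hl.1.cons (ih hl.2)

lemma IsPPT.samples_ofFn {n : ℕ} {f : Fin n → Data → PMF Data} (hf : ∀ u, IsPPT (f u)) :
    IsPPT fun d => samples (List.ofFn fun u => f u d) :=
  (isPPT_samples (List.ofFn f) (by simpa [List.mem_ofFn])).congr fun d => by
    simp [List.map_ofFn, Function.comp_def]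

lemma IsPPT.samples_replicate {f : Data → PMF Data} (hf : IsPPT f) (n : ℕ) :
    IsPPT fun d => samples (List.replicate n (f d)) :=
  (isPPT_samples (List.replicate n f) (by simp +contextual [List.mem_replicate, hf])).congr
    fun d => by simp

lemma IsPPT.bits {f : Data → Data} (hf : IsPolyFun f) (P : Polynomial ℕ) :
    IsPPT fun d => bits (P.eval (f d).length) := (isPPT_bits P).comp hf

lemma IsPPT.branch' {c : Data → Data} {f g : Data → PMF Data} (hc : IsPolyFun c) (hf : IsPPT f)
    (hg : IsPPT g) : IsPPT fun d => (c d).branch (f d) (g d) :=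
  (hf.branch hg hc).congr fun _ => PMF.pure_bind _ _

/-! ### Tables -/

@[simp] lemma nth_zero (a b : Data) : (Data.cons a b).nth 0 = a := rfl

@[simp] lemma nth_succ (a b : Data) (i : ℕ) : (Data.cons a b).nth (i + 1) = b.nth i := rfl

lemma nth_ofList_ofFn {n : ℕ} (f : Fin n → Data) (u : Fin n) :
    (Data.ofList (List.ofFn f)).nth u = f u := by
  induction n with
  | zero => exact u.elim0
  | succ n ih =>
    rw [List.ofFn_succ, Data.ofList]
    refine u.cases rfl fun v => ?_
    rw [Fin.val_succ, nth_succ, ih]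

lemma at_ofParty {n : ℕ} (f : Party n → Data) (p : Party n) : (ofParty f).at p = f p := by
  cases p with
  | none => rfl
  | some u =>
    rw [ofParty, Data.ofList, Data.at, nth_succ, nth_ofList_ofFn fun u => f (some u)]

/-- The set of users whose flag in a list is set. -/
def Data.users (n : ℕ) (d : Data) : Finset (Fin n) :=
  Finset.univ.filter fun u => (d.nth u).branch true false

/-- The set of parties whose flag in a table is set. -/
def Data.parties (n : ℕ) (d : Data) : Finset (Party n) :=
  Finset.univ.filter fun p => (d.at p).branch true false

lemma branch_ofBool {α : Type*} (p : Prop) [Decidable p] (x y : α) :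
    (Data.ofBool (decide p)).branch x y = if p then x else y := by
  by_cases h : p <;> simp [h, Data.branch, Data.ofBool]

@[simp] lemma users_ofFn {n : ℕ} (U : Finset (Fin n)) :
    (Data.ofList (List.ofFn fun u => Data.ofBool (decide (u ∈ U)))).users n = U := by
  ext u
  simp [Data.users, nth_ofList_ofFn fun u => Data.ofBool (decide (u ∈ U)), branch_ofBool]

@[simp] lemma parties_ofParty {n : ℕ} (C : Finset (Party n)) :
    (ofParty fun p => Data.ofBool (decide (p ∈ C))).parties n = C := by
  ext p
  simp [Data.parties, at_ofParty, branch_ofBool]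

lemma ite_parties {α : Type*} {n : ℕ} (d : Data) (p : Party n) (x y : α) :
    (if p ∈ d.parties n then x else y) = (d.at p).branch x y := by
  simp only [Data.parties, Finset.mem_filter, Finset.mem_univ, true_and]
  cases d.at p <;> simp [Data.branch]

lemma ite_users {α : Type*} {n : ℕ} (d : Data) (u : Fin n) (x y : α) :
    (if u ∈ d.users n then x else y) = (d.nth u).branch x y := by
  simp only [Data.users, Finset.mem_filter, Finset.mem_univ, true_and]
  cases d.nth u <;> simp [Data.branch]

@[fun_prop]
lemma IsPolyFun.at {n : ℕ} {f : Data → Data} (hf : IsPolyFun f) (p : Party n) :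
    IsPolyFun fun d => (f d).at p := by
  cases p <;> exact hf.nth _

@[fun_prop]
lemma IsPolyFun.ite_parties {n : ℕ} {c f g : Data → Data} {p : Party n} (hc : IsPolyFun c)
    (hf : IsPolyFun f) (hg : IsPolyFun g) :
    IsPolyFun fun d => if p ∈ (c d).parties n then f d else g d := by
  simp only [FL.ite_parties]
  exact (hc.at p).branch hf hg

lemma IsPPT.ite_honest {n : ℕ} {b c : Data → Data} {u : Fin n} {f g : Data → PMF Data}
    (hb : IsPolyFun b) (hc : IsPolyFun c) (hf : IsPPT f) (hg : IsPPT g) :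
    IsPPT fun d => if u ∈ (b d).users n ∧ some u ∉ (c d).parties n then f d else g d := by
  simp only [ite_and, ite_not, FL.ite_parties, ite_users]
  exact .branch' (hb.nth u) (.branch' (hc.at _) hg hf) hg

/-! ### Computational indistinguishability -/

namespace Indist

variable {X Y W : ℕ → PMF Data}

lemma refl (X : ℕ → PMF Data) : Indist X X := by
  intro D _ a _
  simp only [sub_self, abs_zero]
  exact superpolynomialDecay_zero _ _

lemma congr {X' Y' : ℕ → PMF Data} (h : Indist X Y) (hX : ∀ k, X k = X' k)
    (hY : ∀ k, Y k = Y' k) : Indist X' Y' := by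
  rwa [← funext hX, ← funext hY]

lemma of_le {D : Data → PMF Data} {a : ℕ → Data} {f : ℕ → ℝ}
    (hf : SuperpolynomialDecay atTop (fun k : ℕ => (k : ℝ)) f)
    (h : ∀ k, |accept D k (a k) (X k) - accept D k (a k) (Y k)| ≤ f k) :
    SuperpolynomialDecay atTop (fun k : ℕ => (k : ℝ))
      fun k => |accept D k (a k) (X k) - accept D k (a k) (Y k)| :=
  hf.trans_abs_le fun k => by
    rw [abs_abs]; exact (h k).trans (le_abs_self _)

lemma trans (h₁ : Indist X Y) (h₂ : Indist Y W) : Indist X W := fun D hD a ha =>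
  of_le ((h₁ D hD a ha).add (h₂ D hD a ha)) fun _ => abs_sub_le _ _ _

/-- A polynomial-time algorithm with polynomial-size advice preserves indistinguishability. -/
lemma bind (h : Indist X Y) {F : Data → PMF Data} (hF : IsPPT F) {a : ℕ → Data}
    (ha : PolyBounded a) :
    Indist (fun k => (X k).bind fun s => F (Data.ofList [Data.unary k, a k, s]))
      (fun k => (Y k).bind fun s => F (Data.ofList [Data.unary k, a k, s])) := by
  intro D hD e he
  -- The new distinguisher gets both advice strings as a pair: the first component is for `D`, the
  -- second for `F`.
  have hD' : IsPPT fun d => (F (Data.ofList [d.nth 0, (d.nth 1).snd, d.nth 2])).bind fun r =>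
      D (Data.ofList [d.nth 0, (d.nth 1).fst, r]) := by
    refine .bind_with (.comp hF ?_) (.comp hD ?_) <;> simp only [Data.ofList] <;> fun_prop
  have hb : PolyBounded fun k => Data.cons (e k) (a k) := by
    obtain ⟨b, hb⟩ := he
    obtain ⟨c, hc⟩ := ha
    refine ⟨b + c + 1, fun k => ?_⟩
    have := hb k
    have := hc k
    simp only [Data.size, Polynomial.eval_add, Polynomial.eval_one]; omega
  have := h _ hD' _ hb
  simpa [accept, PMF.bind_bind, Data.ofList] using this

/-- Otherwise `|f|` would lie strictly below the absolute value of the mean on the whole support.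
Averaging, with strict inequality at one point of positive mass, would make that value smaller than
itself. -/
lemma exists_abs_tsum_le {α : Type*} (p : PMF α) (f : α → ℝ) (hf : ∀ z, |f z| ≤ 1) :
    ∃ z ∈ p.support, |∑' z, (p z).toReal * f z| ≤ |f z| := by
  by_contra! h
  have hp : Summable fun z => (p z).toReal := ENNReal.summable_toReal p.tsum_coe_ne_top
  have h1 : ∑' z, (p z).toReal = 1 := by
    rw [← ENNReal.tsum_toReal_eq p.apply_ne_top, p.tsum_coe, ENNReal.toReal_one]
  have hs : Summable fun z => (p z).toReal * |f z| :=
    hp.of_nonneg_of_le (fun z => by positivity) fun z =>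
      mul_le_of_le_one_right ENNReal.toReal_nonneg (hf z)
  set A := |∑' z, (p z).toReal * f z| with hA
  have hA1 : A ≤ ∑' z, (p z).toReal * |f z| := by
    have := norm_tsum_le_tsum_norm (f := fun z => (p z).toReal * f z)
      (by simpa [abs_mul] using hs)
    simpa [abs_mul] using this
  obtain ⟨z₀, hz₀⟩ := p.support_nonempty
  have hlt : ∑' z, (p z).toReal * |f z| < ∑' z, (p z).toReal * A := by
    refine Summable.tsum_lt_tsum (i := z₀) (fun z => ?_) ?_ hs (hp.mul_right A)
    · by_cases hz : z ∈ p.support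
      · exact mul_le_mul_of_nonneg_left (h z hz).le ENNReal.toReal_nonneg
      · simp [(PMF.apply_eq_zero_iff p z).2 hz]
    · exact mul_lt_mul_of_pos_left (h z₀ hz₀)
        (ENNReal.toReal_pos ((PMF.mem_support_iff p z₀).1 hz₀) (p.apply_ne_top z₀))
  rw [tsum_mul_right, h1, one_mul] at hlt
  exact absurd hlt (not_lt.2 hA1)

lemma accept_nonneg (D : Data → PMF Data) (k : ℕ) (a : Data) (p : PMF Data) :
    0 ≤ accept D k a p := ENNReal.toReal_nonneg

lemma accept_le_one (D : Data → PMF Data) (k : ℕ) (a : Data) (p : PMF Data) :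
    accept D k a p ≤ 1 :=
  ENNReal.toReal_le_of_le_ofReal zero_le_one (by rw [ENNReal.ofReal_one]; exact PMF.coe_le_one _ _)

lemma accept_bind (D : Data → PMF Data) (k : ℕ) (a : Data) (p : PMF Data) (f : Data → PMF Data) :
    accept D k a (p.bind f) = ∑' z, (p z).toReal * accept D k a (f z) := by
  simp only [accept, PMF.bind_bind]
  rw [PMF.bind_apply, ENNReal.tsum_toReal_eq fun z =>
    ENNReal.mul_ne_top (p.apply_ne_top z) (PMF.apply_ne_top _ _)]
  simp only [ENNReal.toReal_mul]

/-- Indistinguishability for all advice strings of polynomial size implies indistinguishability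
for random ones. -/
lemma average {X Y : ℕ → Data → PMF Data} {Z : ℕ → PMF Data}
    (hZ : ∃ b : Polynomial ℕ, ∀ k, ∀ z ∈ (Z k).support, z.size ≤ b.eval k)
    (h : ∀ z, PolyBounded z → Indist (fun k => X k (z k)) (fun k => Y k (z k))) :
    Indist (fun k => (Z k).bind (X k)) (fun k => (Z k).bind (Y k)) := by
  intro D hD a ha
  -- For each `k`, some outcome has at least the average advantage. These outcomes form the advice
  -- sequence; they only have to be of polynomial size.
  have key : ∀ k, ∃ z ∈ (Z k).support,
      |accept D k (a k) ((Z k).bind (X k)) - accept D k (a k) ((Z k).bind (Y k))| ≤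
        |accept D k (a k) (X k z) - accept D k (a k) (Y k z)| := by
    intro k
    obtain ⟨z, hz, hle⟩ := exists_abs_tsum_le (Z k)
      (fun z => accept D k (a k) (X k z) - accept D k (a k) (Y k z)) fun z =>
        abs_sub_le_iff.2
          ⟨(sub_le_self _ (accept_nonneg ..)).trans (accept_le_one ..),
            (sub_le_self _ (accept_nonneg ..)).trans (accept_le_one ..)⟩
    refine ⟨z, hz, le_of_eq_of_le ?_ hle⟩
    have hs : ∀ f : Data → PMF Data,
        Summable fun z => (Z k z).toReal * accept D k (a k) (f z) := fun f =>
      (ENNReal.summable_toReal (Z k).tsum_coe_ne_top).of_nonneg_of_le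
        (fun z => mul_nonneg ENNReal.toReal_nonneg (accept_nonneg ..))
        fun z => mul_le_of_le_one_right ENNReal.toReal_nonneg (accept_le_one ..)
    simp only [accept_bind, mul_sub]
    rw [(hs _).tsum_sub (hs _)]
  choose z hz hle using key
  obtain ⟨b, hb⟩ := hZ
  exact of_le (h z ⟨b, fun k => hb k _ (hz k)⟩ D hD a ha) hle

end Indist

/-! ### Sizes of encodings -/

namespace PolyBounded

lemma const (a : Data) : PolyBounded fun _ => a := ⟨Polynomial.C a.size, fun k => by simp⟩

lemma cons {a b : ℕ → Data} (ha : PolyBounded a) (hb : PolyBounded b) :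
    PolyBounded fun k => Data.cons (a k) (b k) := by
  obtain ⟨p, hp⟩ := ha
  obtain ⟨q, hq⟩ := hb
  refine ⟨p + q + 1, fun k => ?_⟩
  have := hp k
  have := hq k
  simp only [Data.size, Polynomial.eval_add, Polynomial.eval_one]; omega

lemma ofFn {n : ℕ} {a : Fin n → ℕ → Data} (ha : ∀ u, PolyBounded (a u)) :
    PolyBounded fun k => Data.ofList (List.ofFn fun u => a u k) := by
  induction n with
  | zero => exact const _
  | succ n ih =>
    simp only [List.ofFn_succ, Data.ofList]
    exact (ha 0).cons (ih fun u => ha u.succ)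

end PolyBounded

lemma size_ofList_le (l : List Data) (c : ℕ) (h : ∀ a ∈ l, a.size ≤ c) :
    (Data.ofList l).size ≤ l.length * (c + 1) + 1 := by
  induction l with
  | nil => simp [Data.ofList, Data.size]
  | cons a l ih =>
    simp only [List.mem_cons, forall_eq_or_imp] at h
    have := ih h.2
    have := h.1
    simp only [Data.ofList, Data.size, List.length_cons, Nat.succ_mul]; omega

lemma size_unary (k : ℕ) : (Data.unary k).size = 2 * k + 1 := by
  induction k with
  | zero => rfl
  | succ k ih => rw [unary_succ, Data.size, ih, Data.size]; ring

lemma polyBounded_unary : PolyBounded Data.unary :=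
  ⟨2 * Polynomial.X + 1, fun k => by simp [size_unary]⟩

lemma size_ofNat_le {a B : ℕ} (h : a ≤ B) : (Data.ofNat a).size ≤ B.size * 4 + 1 := by
  refine (size_ofList_le _ 3 ?_).trans ?_
  · intro d hd
    obtain ⟨b, -, rfl⟩ := List.mem_map.1 hd
    cases b <;> simp [Data.ofBool, Data.size]
  · rw [List.length_map, Nat.size_eq_bits_len]
    have := Nat.size_le_size h
    omega

lemma polyBounded_ofModel (P : Params) {y : ∀ k, Fin (P.dim k) → ℕ}
    (hy : ∀ k i, y k i < P.bound k) : PolyBounded fun k => Data.ofModel (y k) := by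
  obtain ⟨b, hb⟩ := P.dim_poly
  obtain ⟨c, hc⟩ := P.bound_poly
  refine ⟨b * (c * 4 + 2) + 1, fun k => ?_⟩
  refine (size_ofList_le _ ((P.bound k).size * 4 + 1) ?_).trans ?_
  · intro d hd
    obtain ⟨i, rfl⟩ := (List.mem_ofFn' _ _).1 hd
    exact size_ofNat_le (hy k i).le
  · rw [List.length_ofFn]
    simp only [Polynomial.eval_add, Polynomial.eval_mul, Polynomial.eval_ofNat,
      Polynomial.eval_one]
    have := hb k
    have := hc k
    gcongr ?_ * ?_ + 1
    omega

/-! ### The sessions in polynomial time -/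

attribute [fun_prop] ZKProof.commit_poly ZKProof.prover_poly ZKProof.verifier_poly
  ZKProof.verdict_poly ZKProof.check_poly Encryption.dec_poly Adversary.zk_poly Adversary.agg_poly

lemma IsPolyFun.record {com t : Data → Data} {c r : Data → List Data} (hcom : IsPolyFun com)
    (hc : PolyList c) (hr : PolyList r) (ht : IsPolyFun t) :
    IsPolyFun fun d => ZKProof.record (com d) (c d, r d) (t d) :=
  hcom.cons (hc.ofList.cons (hr.ofList.cons (ht.cons (const _))))

lemma IsPolyFun.challenge (Z : ZKProof) {k pp com t : Data → Data} {L : Data → List Data}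
    (hk : IsPolyFun k) (hpp : IsPolyFun pp) (hcom : IsPolyFun com) (ht : IsPolyFun t)
    (hL : PolyList L) :
    IsPolyFun fun d => Z.challenge (k d).length (pp d) (com d) (t d) (L d) :=
  Z.verifier_poly.comp
    (hk.unary_length.cons (hpp.cons (hcom.cons (ht.cons (hL.ofList.cons (const _))))))

/-- In the hybrid argument the distinguisher runs the remaining honest sessions by itself, which
requires this. -/
lemma IsPPT.transcript (Z : ZKProof) {k pp x : Data → Data} (hk : IsPolyFun k)
    (hpp : IsPolyFun pp) (hx : IsPolyFun x) :
    IsPPT fun d => Z.transcript (k d).length (pp d) (x d) := by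
  refine .bind_with (.bits hk _) (.bind_with (.bits (by fun_prop) _)
    (.map_with (.bits (by fun_prop) _) ?_))
  have hcom : IsPolyFun fun e : Data => Z.commit (Data.ofList
      [Data.unary (k e.fst.fst.fst).length, pp e.fst.fst.fst, x e.fst.fst.fst, e.fst.fst.snd]) := by
    simp only [Data.ofList]; fun_prop
  have := PolyList.exchange
    (V := fun e => Z.challenge (k e.fst.fst.fst).length (pp e.fst.fst.fst) (Z.commit (Data.ofList
      [Data.unary (k e.fst.fst.fst).length, pp e.fst.fst.fst, x e.fst.fst.fst, e.fst.fst.snd]))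
      e.snd)
    (Q := fun e cs => Z.prover (Data.ofList [Data.unary (k e.fst.fst.fst).length,
      pp e.fst.fst.fst, x e.fst.fst.fst, e.fst.fst.snd, e.fst.snd, Data.ofList cs]))
    (fun L hL => .challenge Z (by fun_prop) (by fun_prop) hcom (by fun_prop) hL)
    (fun L hL => by
      have := hL.ofList
      simp only [Data.ofList]
      refine Z.prover_poly.comp (.cons (by fun_prop) (.cons (by fun_prop) (.cons (by fun_prop)
        (.cons (by fun_prop) (.cons (by fun_prop) (.cons this (.const _))))))))
    Z.rounds
  exact .record hcom this.1 this.2 (by fun_prop)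

/-! ### The framework as post-processing of the aggregation -/

namespace Framework

variable (n : ℕ) (E : Encryption) (G : Aggregation) (Z : ZKProof) (adv : Adversary)

@[fun_prop]
lemma isPolyFun_commitments {k s : Data → Data} (hk : IsPolyFun k) (hs : IsPolyFun s) :
    IsPolyFun fun d => commitments adv (k d).length (s d) := by
  simp only [commitments, Data.ofList]; fun_prop

lemma polyList_corruptSessions {k c pp vs s : Data → Data} (hk : IsPolyFun k) (hc : IsPolyFun c)
    (hpp : IsPolyFun pp) (hvs : IsPolyFun vs) (hs : IsPolyFun s) :
    (PolyList fun d =>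
      (corruptSessions Z adv (k d).length ((c d).parties n) (pp d) (vs d) (s d)).1) ∧
    PolyList fun d =>
      (corruptSessions Z adv (k d).length ((c d).parties n) (pp d) (vs d) (s d)).2 := by
  refine PolyList.exchange (fun L hL => ?_) (fun L hL => ?_) _
  · exact .ofFn fun u => .ite_parties hc (.challenge Z hk hpp (by fun_prop) (by fun_prop)
      (hL.map (by fun_prop))) (.const _)
  · exact adv.zk_poly.comp (.cons (by fun_prop) (.cons hs (.cons hL.ofList (.const _))))

/-- What the adversary knows at the start, computed from the inputs `inp` of the corrupted parties
and the list `r` of the public parameters, its random bits, the honest transcripts, the random bits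
of the verifier and the auxiliary input. -/
def knowledge (inp r : Data) : Data :=
  Data.ofList [inp, r.nth 0, r.nth 4, r.nth 1,
    if none ∈ (inp.nth 0).parties n then r.nth 2 else Data.nil,
    if none ∈ (inp.nth 0).parties n then r.nth 3 else Data.nil]

/-- The auxiliary input of the adversary in the aggregation. -/
def auxiliary (k : ℕ) (inp r : Data) : Data :=
  Data.ofList [knowledge n inp r, Data.ofList (corruptSessions Z adv k ((inp.nth 0).parties n)
    (r.nth 0) (r.nth 3) (knowledge n inp r)).1]

/-- The strategy in the aggregation of an adversary that computes the auxiliary input of `adv`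
by itself. -/
def aggStrategy (d : Data) : Data :=
  adv.agg (Data.ofList [Data.unary (d.nth 0).length, Data.ofList [(d.nth 1).nth 0, (d.nth 1).nth 1,
    auxiliary n Z adv (d.nth 0).length ((d.nth 1).nth 0) ((d.nth 1).nth 2)], d.nth 2])

/-- The view in the framework, computed from the view `v` in the aggregation with the strategy
`aggStrategy`. -/
def complete (k : ℕ) (v : Data) : Data :=
  let inp := (v.nth 0).nth 0
  let r := (v.nth 0).nth 2
  let C := (inp.nth 0).parties n
  Data.ofList [Data.ofList [Data.ofList [inp, (v.nth 0).nth 1, auxiliary n Z adv k inp r],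
      v.nth 1, v.nth 2],
    if none ∈ C then
      compute E Z k (r.nth 0) (inp.nth 3)
        (sessions Z adv k C (r.nth 0) (r.nth 2) (r.nth 3) (knowledge n inp r)) ((v.nth 2).nth 1)
    else Data.nil]

@[fun_prop]
lemma isPolyFun_knowledge {inp r : Data → Data} (hi : IsPolyFun inp) (hr : IsPolyFun r) :
    IsPolyFun fun d => knowledge n (inp d) (r d) := by
  simp only [knowledge, Data.ofList]; fun_prop

@[fun_prop]
lemma isPolyFun_auxiliary {k inp r : Data → Data} (hk : IsPolyFun k) (hi : IsPolyFun inp)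
    (hr : IsPolyFun r) : IsPolyFun fun d => auxiliary n Z adv (k d).length (inp d) (r d) :=
  .cons (by fun_prop) (.cons (polyList_corruptSessions n Z adv hk (by fun_prop) (by fun_prop)
    (by fun_prop) (by fun_prop)).1.ofList (.const _))

lemma isPolyFun_aggStrategy : IsPolyFun (aggStrategy n Z adv) := by
  unfold aggStrategy; simp only [Data.ofList]; fun_prop

@[fun_prop]
lemma isPolyFun_sessions {k c pp ts vs s : Data → Data} (hk : IsPolyFun k) (hc : IsPolyFun c)
    (hpp : IsPolyFun pp) (hts : IsPolyFun ts) (hvs : IsPolyFun vs) (hs : IsPolyFun s) (u : Fin n) :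
    IsPolyFun fun d =>
      sessions Z adv (k d).length ((c d).parties n) (pp d) (ts d) (vs d) (s d) u := by
  have h := polyList_corruptSessions n Z adv hk hc hpp hvs hs
  exact .ite_parties hc (.record (by fun_prop) (h.1.map (by fun_prop)) (h.2.map (by fun_prop))
    (by fun_prop)) (by fun_prop)

@[fun_prop]
lemma isPolyFun_compute {k pp sk c : Data → Data} {tr : Data → Fin n → Data} (hk : IsPolyFun k)
    (hpp : IsPolyFun pp) (hsk : IsPolyFun sk) (htr : ∀ u, IsPolyFun fun d => tr d u)
    (hc : IsPolyFun c) :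
    IsPolyFun fun d => compute E Z (k d).length (pp d) (sk d) (tr d) (c d) := by
  have hm : IsPolyFun fun d => E.dec (Data.ofList [Data.unary (k d).length, sk d, c d]) := by
    simp only [Data.ofList]; fun_prop
  have hv : ∀ u, IsPolyFun fun d =>
      Z.verdict (Data.ofList [Data.unary (k d).length, pp d, tr d u]) := fun u =>
    Z.verdict_poly.comp (.cons (by fun_prop) (.cons hpp (.cons (htr u) (.const _))))
  exact .cons (.ofFn hv) (.cons hm (.cons (Z.check_poly.comp (.cons (by fun_prop)
    (.cons hpp (.cons hm (.cons (.ofFn fun u => .keep (hv u) (.nth (htr u) 0)) (.const _))))))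
      (.const _)))

@[fun_prop]
lemma isPolyFun_complete {k v : Data → Data} (hk : IsPolyFun k) (hv : IsPolyFun v) :
    IsPolyFun fun d => complete n E Z adv (k d).length (v d) := by
  have : IsPolyFun fun d => compute E Z (k d).length (((v d).nth 0 |>.nth 2).nth 0)
      (((v d).nth 0 |>.nth 0).nth 3)
      (sessions Z adv (k d).length ((((v d).nth 0 |>.nth 0).nth 0).parties n)
        (((v d).nth 0 |>.nth 2).nth 0) (((v d).nth 0 |>.nth 2).nth 2)
        (((v d).nth 0 |>.nth 2).nth 3)
        (knowledge n ((v d).nth 0 |>.nth 0) ((v d).nth 0 |>.nth 2))) (((v d).nth 2).nth 1) :=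
    isPolyFun_compute n E Z hk (by fun_prop) (by fun_prop) (fun u => isPolyFun_sessions n Z adv
      (by fun_prop) (by fun_prop) (by fun_prop) (by fun_prop) (by fun_prop) (by fun_prop) u)
      (by fun_prop)
  exact .cons (.cons (.cons (by fun_prop) (.cons (by fun_prop) (.cons (by fun_prop) (.const _))))
    (.cons (by fun_prop) (.cons (by fun_prop) (.const _))))
    (.cons (.ite_parties (by fun_prop) this (.const _)) (.const _))

variable {n}

/-- The data on which the auxiliary input of the adversary in the aggregation depends, apart from
the inputs of the corrupted parties. -/
def resources (pp w ts vs z : Data) : Data := Data.ofList [pp, w, ts, vs, z]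

lemma knowledge_inputsOf (C : Finset (Party n)) (U : Finset (Fin n)) (x : Fin n → Data)
    (key pp z w ts vs : Data) :
    knowledge n (inputsOf C U x key) (resources pp w ts vs z) = start C U x key pp z w ts vs := by
  simp only [knowledge, inputsOf, resources, start, Data.ofList, nth_zero, nth_succ,
    parties_ofParty]

/-- `aggStrategy` finds the corrupted inputs and `r` in its start data and rebuilds the auxiliary
input, so both adversaries answer alike in every round. The detour is needed because that auxiliary
input depends on the keys, while privacy of the aggregation allows only auxiliary inputs fixed
before key generation. -/
lemma final_aggStrategy (k : ℕ) (C : Finset (Party n)) (U : Finset (Fin n)) (x : Fin n → Data)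
    (key t r : Data) :
    G.final k C U x key t (aggStrategy n Z adv) r =
      G.final k C U x key t adv.agg (auxiliary n Z adv k (inputsOf C U x key) r) := by
  have : G.round k C U x key t (aggStrategy n Z adv) r =
      G.round k C U x key t adv.agg (auxiliary n Z adv k (inputsOf C U x key) r) := by
    funext s
    simp only [Aggregation.round, aggStrategy, Aggregation.start, Data.ofList, nth_zero, nth_succ,
      length_unary]
  rw [Aggregation.final, Aggregation.final, this]

/-- The two aggregation views differ only in the auxiliary-input entry, which `complete` recomputes.
The server's result is needed only if the server is corrupted, and then the secret key is entry 3 of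
`inputsOf` and the ciphertext is part of the view. -/
lemma complete_view (k : ℕ) (C : Finset (Party n)) (U : Finset (Fin n)) (x : Fin n → Data)
    (key t pp w ts vs z : Data) :
    complete n E Z adv k
        (G.view k C U x key t (aggStrategy n Z adv) (resources pp w ts vs z)) =
      (let s := start C U x key pp z w ts vs
      let aux := Data.ofList [s, Data.ofList (corruptSessions Z adv k C pp vs s).1]
      Data.ofList [G.view k C U x key t adv.agg aux,
        if none ∈ C then
          compute E Z k pp key.snd (sessions Z adv k C pp ts vs s)
            (G.cipher k C U x key t adv.agg aux)
        else Data.nil]) := by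
  have haux : auxiliary n Z adv k (inputsOf C U x key) (resources pp w ts vs z) =
      Data.ofList [start C U x key pp z w ts vs, Data.ofList (corruptSessions Z adv k C pp vs
        (start C U x key pp z w ts vs)).1] := by
    rw [auxiliary, knowledge_inputsOf]
    simp only [inputsOf, resources, Data.ofList, nth_zero, nth_succ, parties_ofParty]
  have h0 : (inputsOf C U x key).nth 0 = ofParty fun p => Data.ofBool (decide (p ∈ C)) := rfl
  have hcipher : G.cipher k C U x key t (aggStrategy n Z adv) (resources pp w ts vs z) =
      G.cipher k C U x key t adv.agg
        (auxiliary n Z adv k (inputsOf C U x key) (resources pp w ts vs z)) := by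
    rw [Aggregation.cipher, Aggregation.cipher, final_aggStrategy]
  have hview : G.view k C U x key t (aggStrategy n Z adv) (resources pp w ts vs z) =
      Data.ofList [Data.ofList [inputsOf C U x key,
          if none ∈ C then t.at (none : Party n) else Data.nil, resources pp w ts vs z],
        (G.view k C U x key t adv.agg
          (auxiliary n Z adv k (inputsOf C U x key) (resources pp w ts vs z))).nth 1,
        (G.view k C U x key t adv.agg
          (auxiliary n Z adv k (inputsOf C U x key) (resources pp w ts vs z))).nth 2] := by
    simp only [Aggregation.view, hcipher, final_aggStrategy, Aggregation.start, Data.ofList,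
      nth_zero, nth_succ]
  rw [hview]
  simp only [complete, Data.ofList, nth_zero, nth_succ, h0, parties_ofParty, knowledge_inputsOf]
  rw [haux]
  by_cases hC : none ∈ C <;>
    simp only [hC, if_true, if_false, Aggregation.view, Aggregation.start, inputsOf, resources,
      Data.ofList, nth_zero, nth_succ]

end Framework

/-! ### The hybrid argument over the sessions of the honest users -/

/-- The entries are independent, so entry `j` may be drawn ahead of the others. In the hybrid step
it is the transcript supplied by the challenge. -/
lemma bind_samples_update {n : ℕ} (f : Fin n → PMF Data) (j : Fin n) (p : PMF Data) :
    (p.bind fun t => samples (List.ofFn (Function.update f j (PMF.pure t)))) =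
      samples (List.ofFn (Function.update f j p)) := by
  induction n with
  | zero => exact j.elim0
  | succ n ih =>
    obtain ⟨a, g, rfl⟩ : ∃ a g, f = Fin.cons a g :=
      ⟨f 0, fun i => f i.succ, (Fin.cons_self_tail f).symm⟩
    refine j.cases ?_ fun i => ?_
    · simp [Fin.update_cons_zero, List.ofFn_succ, samples, PMF.pure_bind]
    · simp only [← Fin.cons_update, List.ofFn_succ, Fin.cons_zero, Fin.cons_succ, samples]
      rw [PMF.bind_comm]
      simp only [← ih g i, PMF.map_bind]

lemma bind_congr_fun {p : PMF Data} {f g : Data → PMF Data} (h : ∀ a, f a = g a) :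
    p.bind f = p.bind g := by rw [funext h]

namespace Framework

variable {n : ℕ} (E : Encryption) (G : Aggregation) (Z : ZKProof) (adv : Adversary)

/-- Simulated transcripts of the sessions of the honest users. -/
def simSessions (simZ : Data → PMF Data) (k : ℕ) (C : Finset (Party n)) (U : Finset (Fin n))
    (pp : Data) : PMF Data :=
  samples (List.ofFn fun u =>
    if u ∈ U ∧ some u ∉ C then simZ (Data.ofList [Data.unary k, pp]) else PMF.pure Data.nil)

/-- The transcripts of the sessions of the honest users, of which those of the users before `j` are
simulated. -/
def hybridSessions (simZ : Data → PMF Data) (j k : ℕ) (C : Finset (Party n)) (U : Finset (Fin n))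
    (x : Fin n → Data) (pp : Data) (u : Fin n) : PMF Data :=
  if u ∈ U ∧ some u ∉ C then
    if (u : ℕ) < j then simZ (Data.ofList [Data.unary k, pp]) else Z.transcript k pp (x u)
  else PMF.pure Data.nil

/-- The case distinctions concern only `j`, `C`, `U` and `u`, which do not vary with the input, so
they are resolved outside the algorithm. -/
lemma isPPT_hybridSessions {simZ : Data → PMF Data} (hsim : IsPPT simZ) (j : ℕ)
    (C : Finset (Party n)) (U : Finset (Fin n)) (u : Fin n) {k xs pp : Data → Data}
    (hk : IsPolyFun k) (hxs : IsPolyFun xs) (hpp : IsPolyFun pp) :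
    IsPPT fun d => hybridSessions Z simZ j (k d).length C U (fun u => (xs d).nth u) (pp d) u := by
  unfold hybridSessions
  split_ifs
  · refine hsim.comp ?_
    simp only [Data.ofList]; fun_prop
  · exact .transcript Z hk hpp (hxs.nth u)
  · exact IsPolyFun.const _

variable {P : Params} {clean : ∀ k, (Fin (P.dim k) → ℕ) → Prop}

lemma polyBounded_models {x : Inputs P} (hx : x.Valid) :
    PolyBounded fun k => Data.ofList (List.ofFn (x.enc k)) :=
  PolyBounded.ofFn (a := fun u k => x.enc k u)
    fun u => polyBounded_ofModel P fun k i => hx.1 k u i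

lemma nth_models (x : Inputs P) (k : ℕ) :
    (fun u : Fin P.users => (Data.ofList (List.ofFn (x.enc k))).nth u) = x.enc k :=
  funext fun u => nth_ofList_ofFn _ u

/-- Consecutive hybrids differ in the session of a single user. The number of users is independent
of `k`, so finitely many uses of transitivity suffice. The public parameters stay in the output
because all sessions share them. -/
lemma indist_hybridSessions {simZ : Data → PMF Data} (hsim : IsPPT simZ)
    (hZ : ∀ x : ∀ k, Fin (P.dim k) → ℕ, (∀ k i, x k i < P.bound k) → (∀ k, clean k (x k)) →
      Indist
        (fun k => (Z.setup (Data.unary k)).bind fun pp =>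
          (Z.transcript k pp (Data.ofModel (x k))).map fun t => Data.ofList [pp, t])
        (fun k => (Z.setup (Data.unary k)).bind fun pp =>
          (simZ (Data.ofList [Data.unary k, pp])).map fun t => Data.ofList [pp, t]))
    (C : Finset (Party P.users)) (U : Finset (Fin P.users)) {x : Inputs P} (hx : x.Valid)
    (hclean : ∀ k, ∀ u ∈ U, some u ∉ C → clean k (x k u)) (j : ℕ) (hj : j ≤ P.users) :
    Indist
      (fun k => (Z.setup (Data.unary k)).bind fun pp =>
        (honestSessions Z k C U (x.enc k) pp).map fun ts => Data.ofList [pp, ts])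
      (fun k => (Z.setup (Data.unary k)).bind fun pp =>
        (samples (List.ofFn (hybridSessions Z simZ j k C U (x.enc k) pp))).map
          fun ts => Data.ofList [pp, ts]) := by
  induction j with
  | zero =>
    have h : ∀ k pp, samples (List.ofFn (hybridSessions Z simZ 0 k C U (x.enc k) pp)) =
        honestSessions Z k C U (x.enc k) pp := fun k pp => by
      unfold honestSessions
      congr 2
    simpa only [h] using Indist.refl _
  | succ j ih =>
    refine (ih (by omega)).trans ?_
    let u₀ : Fin P.users := ⟨j, hj⟩
    have hsame : ∀ k pp, ∀ u ≠ u₀, hybridSessions Z simZ (j + 1) k C U (x.enc k) pp u =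
        hybridSessions Z simZ j k C U (x.enc k) pp u := by
      intro k pp u hu
      have : (u : ℕ) < j + 1 ↔ (u : ℕ) < j := by
        have : (u : ℕ) ≠ j := fun h => hu (Fin.ext h)
        omega
      simp only [hybridSessions, this]
    by_cases hu : u₀ ∈ U ∧ some u₀ ∉ C
    · -- replace the transcript of the user `u₀`, with the other ones sampled by the distinguisher
      let F : Data → PMF Data := fun d =>
        (samples (List.ofFn fun u : Fin P.users => if u = u₀ then PMF.pure ((d.nth 2).nth 1) else
          hybridSessions Z simZ j (d.nth 0).length C U (fun u => (d.nth 1).nth u)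
            ((d.nth 2).nth 0) u)).map fun ts => Data.ofList [(d.nth 2).nth 0, ts]
      have hF : IsPPT F := by
        refine .map_with (.samples_ofFn fun u => ?_) (by simp only [Data.ofList]; fun_prop)
        split_ifs
        · exact IsPolyFun.nth (.nth .id 2) 1
        · exact isPPT_hybridSessions Z hsim j C U u (by fun_prop) (by fun_prop) (by fun_prop)
      have h := (hZ (fun k => x k u₀) (fun k i => hx.1 k u₀ i)
        fun k => hclean k u₀ hu.1 hu.2).bind hF (polyBounded_models hx)
      have hFval : ∀ k pp t, F (Data.ofList [Data.unary k, Data.ofList (List.ofFn (x.enc k)),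
          Data.ofList [pp, t]]) = (samples (List.ofFn (Function.update
            (hybridSessions Z simZ j k C U (x.enc k) pp) u₀ (PMF.pure t)))).map
              fun ts => Data.ofList [pp, ts] := by
        intro k pp t
        simp only [F, Data.ofList.eq_2, Data.ofList.eq_1, nth_zero, nth_succ, length_unary,
          nth_models]
        congr 3
        funext u
        rw [Function.update_apply]
      simp only [PMF.bind_bind, PMF.bind_map, Function.comp_def, hFval] at h
      simp only [← PMF.map_bind, bind_samples_update] at h
      -- Both hybrids are updates at `u₀` of the same family, once by the real and once by the
      -- simulated transcript.
      convert h using 8 with k pp k pp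
      · rw [Function.eq_update_iff]
        simp [hybridSessions, hu, u₀, Inputs.enc]
      · rw [Function.eq_update_iff]
        exact ⟨by simp [hybridSessions, hu, u₀], hsame k _⟩
    · convert Indist.refl _ using 7 with k pp
      funext u
      by_cases h : u = u₀
      · subst h; simp only [hybridSessions, if_neg hu]
      · exact hsame k pp u h

lemma indist_simSessions {simZ : Data → PMF Data} (hsim : IsPPT simZ)
    (hZ : ∀ x : ∀ k, Fin (P.dim k) → ℕ, (∀ k i, x k i < P.bound k) → (∀ k, clean k (x k)) →
      Indist
        (fun k => (Z.setup (Data.unary k)).bind fun pp =>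
          (Z.transcript k pp (Data.ofModel (x k))).map fun t => Data.ofList [pp, t])
        (fun k => (Z.setup (Data.unary k)).bind fun pp =>
          (simZ (Data.ofList [Data.unary k, pp])).map fun t => Data.ofList [pp, t]))
    (C : Finset (Party P.users)) (U : Finset (Fin P.users)) {x : Inputs P} (hx : x.Valid)
    (hclean : ∀ k, ∀ u ∈ U, some u ∉ C → clean k (x k u)) :
    Indist
      (fun k => (Z.setup (Data.unary k)).bind fun pp =>
        (honestSessions Z k C U (x.enc k) pp).map fun ts => Data.ofList [pp, ts])
      (fun k => (Z.setup (Data.unary k)).bind fun pp =>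
        (simSessions simZ k C U pp).map fun ts => Data.ofList [pp, ts]) := by
  have h : ∀ k pp, samples (List.ofFn (hybridSessions Z simZ P.users k C U (x.enc k) pp)) =
      simSessions simZ k C U pp := fun k pp => by
    unfold simSessions
    congr 2
    funext u
    simp [hybridSessions]
  simpa only [h] using indist_hybridSessions Z hsim hZ C U hx hclean P.users le_rfl

/-! ### The simulator -/

variable (n) in
/-- The simulation of the view from the public parameters and the honest transcripts. -/
def simView (simG : Data → PMF Data) (k : ℕ) (inp pp ts xbar z : Data) : PMF Data :=
  (bits (adv.coins.eval k)).bind fun w =>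
  (samples (List.replicate n (bits (Z.verifierCoins.eval k)))).bind fun vs =>
  (E.enc (Data.ofList [Data.unary k, inp.nth 2, xbar])).bind fun c =>
  (simG (Data.ofList [Data.unary k, inp, c, resources pp w ts vs z])).map (complete n E Z adv k)

lemma isPPT_simView {simG : Data → PMF Data} (hsim : IsPPT simG)
    {k inp pp ts xbar z : Data → Data} (hk : IsPolyFun k) (hi : IsPolyFun inp) (hpp : IsPolyFun pp)
    (hts : IsPolyFun ts) (hx : IsPolyFun xbar) (hz : IsPolyFun z) :
    IsPPT fun d => simView n E Z adv simG (k d).length (inp d) (pp d) (ts d) (xbar d) (z d) := by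
  refine .bind_with (.bits hk _) (.bind_with (.samples_replicate (.bits (by fun_prop) _) _)
    (.bind_with (E.enc_ppt.comp ?_) (.map_with (hsim.comp ?_) ?_)))
  · simp only [Data.ofList]; fun_prop
  · simp only [resources, Data.ofList]; fun_prop
  · exact isPolyFun_complete n E Z adv (by fun_prop) (by fun_prop)

variable (n) in
/-- The simulator of the framework. -/
def simulator (simG simZ : Data → PMF Data) (d : Data) : PMF Data :=
  (simSessions simZ (d.nth 0).length (((d.nth 1).nth 0).parties n) (((d.nth 1).nth 1).users n)
    (d.nth 2)).bind fun ts =>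
  simView n E Z adv simG (d.nth 0).length (d.nth 1) (d.nth 2) ts (d.nth 3) (d.nth 4)

lemma isPPT_simulator {simG simZ : Data → PMF Data} (hG : IsPPT simG) (hZ : IsPPT simZ) :
    IsPPT (simulator n E Z adv simG simZ) := by
  refine .bind_with (.samples_ofFn fun u => .ite_honest (by fun_prop) (by fun_prop)
    (hZ.comp ?_) (IsPolyFun.const _)) (isPPT_simView E Z adv hG (by fun_prop) (by fun_prop)
      (by fun_prop) (by fun_prop) (by fun_prop) (by fun_prop))
  simp only [Data.ofList]; fun_prop

/-- The distribution of the resources with honest transcripts. -/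
def sampleResources (k : ℕ) (C : Finset (Party n)) (U : Finset (Fin n)) (x : Fin n → Data)
    (z : Data) : PMF Data :=
  (Z.setup (Data.unary k)).bind fun pp =>
  (bits (adv.coins.eval k)).bind fun w =>
  (honestSessions Z k C U x pp).bind fun ts =>
  (samples (List.replicate n (bits (Z.verifierCoins.eval k)))).map fun vs =>
  resources pp w ts vs z

/-- Given all models, the resources are sampled by a polynomial-time algorithm on an input of
polynomial size. Efficiency serves only to bound the size, as `Indist.average` demands. -/
lemma sampleResources_size_le (C : Finset (Party P.users)) (U : Finset (Fin P.users))
    {x : Inputs P} (hx : x.Valid) {z : ℕ → Data} (hz : PolyBounded z) :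
    ∃ b : Polynomial ℕ, ∀ k, ∀ r ∈ (sampleResources Z adv k C U (x.enc k) (z k)).support,
      r.size ≤ b.eval k := by
  have h : IsPPT fun d => sampleResources Z adv (d.nth 0).length C U
      (fun u : Fin P.users => (d.nth 1).nth u) (d.nth 2) := by
    have hs : IsPPT fun d => Z.setup (Data.unary (d.nth 0).length) :=
      Z.setup_ppt.comp (by fun_prop)
    refine .bind_with hs (.bind_with (.bits (by fun_prop) _)
      (.bind_with (.samples_ofFn fun u => ?_)
        (.map_with (.samples_replicate (.bits (by fun_prop) _) _) ?_)))
    · split_ifs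
      · exact .transcript Z (by fun_prop) (by fun_prop) (by fun_prop)
      · exact IsPolyFun.const _
    · simp only [resources, Data.ofList]; fun_prop
  obtain ⟨b, hb⟩ := h.size_le
  obtain ⟨c, hc⟩ :=
    polyBounded_unary.cons ((polyBounded_models hx).cons (hz.cons (.const Data.nil)))
  refine ⟨b.comp c, fun k r hr => ?_⟩
  rw [Polynomial.eval_comp]
  refine (hb (Data.ofList [Data.unary k, Data.ofList (List.ofFn (x.enc k)), z k]) r ?_).trans
    (eval_mono_nat b (hc k))
  simpa only [Data.ofList.eq_2, Data.ofList.eq_1, nth_zero, nth_succ, length_unary,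
    nth_models] using hr

/-- The key pair is independent of the resources, so its generation can be moved behind theirs; then
`complete_view` applies pointwise. -/
lemma view_eq (k : ℕ) (C : Finset (Party n)) (U : Finset (Fin n)) (x : Fin n → Data) (z : Data) :
    view E G Z adv k C U x z =
      (sampleResources Z adv k C U x z).bind fun r =>
        ((E.gen (Data.unary k)).bind fun key => (G.tapes n k).map fun t =>
          G.view k C U x key t (aggStrategy n Z adv) r).map (complete n E Z adv k) := by
  simp only [view, sampleResources, PMF.bind_bind, PMF.bind_map, Function.comp_def, PMF.map_bind,
    PMF.map_comp, complete_view]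
  refine bind_congr_fun fun pp => ?_
  rw [PMF.bind_comm]
  refine bind_congr_fun fun w => ?_
  rw [PMF.bind_comm]
  refine bind_congr_fun fun ts => ?_
  rw [PMF.bind_comm]

lemma nth_inputsOf_two (C : Finset (Party n)) (U : Finset (Fin n)) (x : Fin n → Data)
    (key : Data) : (inputsOf C U x key).nth 2 = key.fst := rfl

lemma isPolyFun_inputsOf (C : Finset (Party n)) (U : Finset (Fin n)) {xs key : Data → Data}
    (hxs : IsPolyFun xs) (hkey : IsPolyFun key) :
    IsPolyFun fun d => inputsOf C U (fun u => (xs d).nth u) (key d) := by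
  refine .cons (.const _) (.cons (.const _) (.cons (by fun_prop) (.cons ?_ (.cons
    (.ofFn fun u => ?_) (.const _))))) <;> split_ifs <;> fun_prop

/-- Two steps: `h₁` simulates the aggregation while the honest transcripts are real, and `h₂` then
simulates the transcripts. -/
theorem indist_view {simG simZ : Data → PMF Data} (hsimG : IsPPT simG)
    (C : Finset (Party P.users)) (U : Finset (Fin P.users)) {x : Inputs P} (hx : x.Valid)
    (hG : ∀ z, PolyBounded z → Indist
        (fun k => (E.gen (Data.unary k)).bind fun key => (G.tapes P.users k).map fun t =>
          G.view k C U (x.enc k) key t (aggStrategy P.users Z adv) (z k))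
        (fun k => (E.gen (Data.unary k)).bind fun key =>
          (E.enc (Data.ofList [Data.unary k, key.fst, x.globalModel U k])).bind fun c =>
          simG (Data.ofList [Data.unary k, inputsOf C U (x.enc k) key, c, z k])))
    (hZ : Indist
      (fun k => (Z.setup (Data.unary k)).bind fun pp =>
        (honestSessions Z k C U (x.enc k) pp).map fun ts => Data.ofList [pp, ts])
      (fun k => (Z.setup (Data.unary k)).bind fun pp =>
        (simSessions simZ k C U pp).map fun ts => Data.ofList [pp, ts]))
    {z : ℕ → Data} (hz : PolyBounded z) :
    Indist
      (fun k => view E G Z adv k C U (x.enc k) (z k))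
      (fun k => (Z.setup (Data.unary k)).bind fun pp => (E.gen (Data.unary k)).bind fun key =>
        simulator P.users E Z adv simG simZ (Data.ofList [Data.unary k,
          inputsOf C U (x.enc k) key, pp, x.globalModel U k, z k])) := by
  have hcomplete : IsPPT fun d =>
      PMF.pure (complete P.users E Z adv (d.nth 0).length (d.nth 2)) :=
    isPolyFun_complete P.users E Z adv (by fun_prop) (by fun_prop)
  have h₁ := (Indist.average
    (X := fun k r => (E.gen (Data.unary k)).bind fun key => (G.tapes P.users k).map fun t =>
      G.view k C U (x.enc k) key t (aggStrategy P.users Z adv) r)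
    (Y := fun k r => (E.gen (Data.unary k)).bind fun key =>
      (E.enc (Data.ofList [Data.unary k, key.fst, x.globalModel U k])).bind fun c =>
      simG (Data.ofList [Data.unary k, inputsOf C U (x.enc k) key, c, r]))
    (sampleResources_size_le Z adv C U hx hz) hG).bind hcomplete
    (.const Data.nil)
  -- Everything that follows the public parameters and the transcripts. The reduction can generate
  -- the keys itself, as they are independent of the parameters; models, global model and auxiliary
  -- input are its advice.
  let F : Data → PMF Data := fun d => (E.gen (Data.unary (d.nth 0).length)).bind fun key =>
    simView P.users E Z adv simG (d.nth 0).length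
      (inputsOf C U (fun u => ((d.nth 1).nth 0).nth u) key) ((d.nth 2).nth 0) ((d.nth 2).nth 1)
      ((d.nth 1).nth 1) ((d.nth 1).nth 2)
  have hF : IsPPT F := by
    have hgen : IsPPT fun d => E.gen (Data.unary (d.nth 0).length) :=
      E.gen_ppt.comp (by fun_prop)
    exact .bind_with hgen (isPPT_simView E Z adv hsimG (by fun_prop)
      (isPolyFun_inputsOf C U (by fun_prop) (by fun_prop)) (by fun_prop) (by fun_prop)
      (by fun_prop) (by fun_prop))
  have hglobal : PolyBounded fun k => x.globalModel U k :=
    polyBounded_ofModel P fun k i => (Finset.sum_le_sum_of_subset (Finset.subset_univ U)).trans_lt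
      (hx.2 k i)
  have h₂ := hZ.bind hF
    (((polyBounded_models hx).cons (hglobal.cons (hz.cons (.const Data.nil)))))
  have hFval : ∀ k pp ts, F (Data.ofList [Data.unary k, Data.cons
      (Data.ofList (List.ofFn (x.enc k))) (Data.cons (x.globalModel U k)
        (Data.cons (z k) Data.nil)), Data.ofList [pp, ts]]) =
      (E.gen (Data.unary k)).bind fun key => simView P.users E Z adv simG k
        (inputsOf C U (x.enc k) key) pp ts (x.globalModel U k) (z k) := by
    intro k pp ts
    simp only [F, Data.ofList.eq_2, Data.ofList.eq_1, nth_zero, nth_succ, length_unary, nth_models]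
  simp only [PMF.bind_bind, PMF.bind_map, Function.comp_def, hFval] at h₂
  refine (h₁.congr (fun k => ?_) fun k => ?_).trans (h₂.congr (fun k => rfl) fun k => ?_)
  · rw [view_eq, PMF.bind_bind]
    refine bind_congr_fun fun r => ?_
    simp only [Data.ofList, nth_zero, nth_succ, length_unary]
    rfl
  -- The intermediate experiment in its two forms, which differ only in the order of independent
  -- samplings.
  · simp only [sampleResources, PMF.bind_bind, PMF.bind_map, Function.comp_def, Data.ofList.eq_2,
      Data.ofList.eq_1, nth_zero, nth_succ, length_unary, simView, nth_inputsOf_two]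
    refine bind_congr_fun fun pp => ?_
    rw [PMF.bind_comm]
    refine bind_congr_fun fun ts => ?_
    rw [PMF.bind_comm (E.gen _)]
    refine bind_congr_fun fun w => ?_
    rw [PMF.bind_comm]
    rfl
  · refine bind_congr_fun fun pp => ?_
    rw [PMF.bind_comm]
    refine bind_congr_fun fun key => ?_
    simp only [simulator, Data.ofList.eq_2, Data.ofList.eq_1, nth_zero, nth_succ, length_unary]
    simp only [inputsOf, Data.ofList.eq_2, Data.ofList.eq_1, nth_zero, nth_succ, parties_ofParty,
      users_ofFn]

end Framework

end FL

end

theorem theorem1 (P : Params) (E : Encryption) (G : Aggregation) (Z : ZKProof)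
    (clean : ∀ k, (Fin (P.dim k) → ℕ) → Prop)
    (hG : G.Private P E) (hZ : Z.ZeroKnowledge P clean) :
    ∀ adv : Adversary, ∃ sim : Data → PMF Data, IsPPT sim ∧
      ∀ (C : Finset (Party P.users)) (U : Finset (Fin P.users)) (x : Inputs P), x.Valid →
        (∀ k, ∀ u ∈ U, some u ∉ C → clean k (x k u)) →
        ∀ z : ℕ → Data, PolyBounded z →
          Indist
            (fun k => Framework.view E G Z adv k C U (x.enc k) (z k))
            (fun k => (Z.setup (Data.unary k)).bind fun pp =>
              (E.gen (Data.unary k)).bind fun key =>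
              sim (Data.ofList [Data.unary k, inputsOf C U (x.enc k) key, pp,
                x.globalModel U k, z k])) := by
  intro adv
  -- `aggStrategy` depends on `adv` but not on the corrupted set, the models or the auxiliary input,
  -- so one simulator serves them all.
  obtain ⟨simG, hsimG, hG⟩ := hG _ (Framework.isPolyFun_aggStrategy P.users Z adv)
  obtain ⟨simZ, hsimZ, hZ⟩ := hZ
  exact ⟨_, Framework.isPPT_simulator E Z adv hsimG hsimZ, fun C U x hx hclean z hz =>
    Framework.indist_view E G Z adv hsimG C U hx (hG C U x hx)
      (Framework.indist_simSessions Z hsimZ hZ C U hx hclean) hz⟩
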